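/- For a hypergraph $\mathcal H=(V,\mathcal E)$, where $\mathcal E$ is a set of subsets of $V$, a transversal is a set $U\subseteq V$ with $U\cap E\neq\emptyset$ for all $E\in\mathcal E$; it is minimal if no proper subset of it is a transversal. For finite $\mathcal H$ let $\|\mathcal H\|=|V|+\sum_{E\in\mathcal E}|E|$. A directed hypergraph $\mathcal D$ consists of a vertex set and of hyperarcs $A=(T(A),H(A))$, where the tail $T(A)$ and the head $H(A)$ are disjoint sets of vertices. It is simple if distinct hyperarcs are distinct pairs; parallel hyperarcs are allowed unless "simple" is said. It is a $BF$-hypergraph if every hyperarc satisfies $|H(A)|=1$ or $|T(A)|=1$. Given a set $P$ of hyperarcs and a vertex $s$, the vertices $B$-connected from $s$ in $P$ form the smallest set that contains $s$ and that contains $H(A)$ for every $A\in P$ whose tail $T(A)$ it contains. An $s$-$t$ hyperpath is an inclusion-wise minimal set $P$ of hyperarcs such that $t$ is $B$-connected from $s$ in $P$. For a hypergraph $\mathcal H=(V,\mathcal E)$ let $\mathcal D_{\mathcal H}$ be the directed hypergraph with vertex set $\mathcal E\cup\{s,t\}$ and with the following hyperarcs: for every $v\in V$ one hyperarc $A_v=(\{s\},\mathcal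 E_v)$, where $\mathcal E_v=\{E\in\mathcal E: v\in E\}$ (one for each $v$, even if some of these pairs coincide), and the hyperarc $A_t=(\mathcal E,\{t\})$. An enumeration problem is solved in output-polynomial time if there are a random access machine program (unit cost, with addition and truncated subtraction on natural numbers) and a polynomial $q$ such that on every instance of size $k$ with $N$ solutions the program outputs every solution exactly once and halts within $q(k+N)$ steps. Finite hypergraphs and directed hypergraphs are given by the numbers of their vertices and of their hyperedges or hyperarcs, followed by a list of the elements of each hyperedge, or of each tail and each head. The size of a hypergraph is $\|\mathcal H\|$, and that of a directed hypergraph is the number of vertices plus $\sum_A(|T(A)|+|H(A)|)$. Theorem. (1) For every hypergraph $\mathcal H$, $\mathcal D_{\mathcal H}$ is a $BF$-hypergraph, and $T\mapsto\{A_v: v\in T\}\cup\{A_t\}$ is a bijection from the set of minimal transversals of $\mathcal H$ to the set of $s$-$t$ hyperpaths of $\mathcal D_{\mathcal H}$. Moreover, $\mathcal D_{\mathcal H}$ is simple if and only if $\mathcal E_u\ne\mathcal E_v$ for all distinct $u,v\in V$. (2) There are a random access machine program and a constant $c$ such that, for every finite hypergraph $\mathcal H$, the program computes a description of $(\mathcal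 D_{\mathcal H},s,t)$ from any description of $\mathcal H$ within $c\,(\|\mathcal H\|+1)$ steps. (3) If the enumeration of all $s$-$t$ hyperpaths of a given simple finite $BF$-hypergraph with two given vertices $s,t$ can be solved in output-polynomial time, then the enumeration of all minimal transversals of a given finite hypergraph can be solved in output-polynomial time. -/

import Mathlib

namespace HyperEnum

/-! ## Minimal transversals -/

/-- `U` is a set of vertices that meets every hyperedge. -/
def IsTransversal {α : Type*} (H : Hypergraph α) (U : Set α) : Prop :=
  U ⊆ H.vertexSet ∧ ∀ e ∈ H.edgeSet, (e ∩ U).Nonempty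

/-- `U` is an inclusion-wise minimal transversal. -/
def IsMinimalTransversal {α : Type*} (H : Hypergraph α) (U : Set α) : Prop :=
  Minimal (IsTransversal H) U

/-- The number of vertices plus the sum of the cardinalities of the hyperedges, for a hypergraph
with finitely many vertices. -/
noncomputable def hypergraphSize {α : Type*} (H : Hypergraph α) : ℕ :=
  H.vertexSet.ncard + ∑ᶠ e ∈ H.edgeSet, e.ncard

/-! ## Directed hypergraphs and hyperpaths -/

/-- A directed hypergraph with vertex set `V` whose hyperarcs are named by `A`. The hyperarc `a` is
the pair `(tail a, head a)` of disjoint vertex sets. Two names may carry the same pair (parallel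
hyperarcs); `IsSimple` excludes this. -/
structure DirHypergraph (V A : Type*) where
  tail : A → Set V
  head : A → Set V
  disjoint : ∀ a, Disjoint (tail a) (head a)

namespace DirHypergraph

variable {V A : Type*}

/-- The hyperarcs form a set of pairs: there are no parallel hyperarcs. -/
def IsSimple (D : DirHypergraph V A) : Prop :=
  Function.Injective fun a => (D.tail a, D.head a)

/-- Every hyperarc is a `B`-hyperarc (one head) or an `F`-hyperarc (one tail). -/
def IsBF (D : DirHypergraph V A) : Prop :=
  ∀ a, (D.head a).ncard = 1 ∨ (D.tail a).ncard = 1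

/-- `D.BConnected P s v`: the vertex `v` is `B`-connected from `s` using only the hyperarcs
in `P`. -/
inductive BConnected (D : DirHypergraph V A) (P : Set A) (s : V) : V → Prop
  | base : BConnected D P s s
  | step (a : A) (ha : a ∈ P) (htail : ∀ u ∈ D.tail a, BConnected D P s u)
      (v : V) (hv : v ∈ D.head a) : BConnected D P s v

/-- `P` is an inclusion-wise minimal set of hyperarcs making `t` `B`-connected from `s`. -/
def IsHyperpath (D : DirHypergraph V A) (s t : V) (P : Set A) : Prop :=
  Minimal (fun Q => D.BConnected Q s t) P

/-- The number of vertices plus the sum of the cardinalities of all tails and heads. -/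
noncomputable def size [Fintype V] [Fintype A] (D : DirHypergraph V A) : ℕ :=
  Fintype.card V + ∑ a, ((D.tail a).ncard + (D.head a).ncard)

end DirHypergraph

/-! ## The directed hypergraph of a hypergraph -/

/-- The vertices of the directed hypergraph of a hypergraph with the set of hyperedges `ε`: the
hyperedges, and two further vertices `s` (`source`) and `t` (`sink`). -/
inductive Node (ε : Type*)
  | edge (e : ε)
  | source
  | sink

/-- The directed hypergraph of `H`. For every vertex `v` of `H` it has one hyperarc `some v`, whose
tail is `{s}` and whose head is the set of the hyperedges of `H` that contain `v`; the only other
hyperarc is `none`, whose tail is the set of all hyperedges of `H` and whose head is `{t}`. -/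
def toDir {α : Type*} (H : Hypergraph α) :
    DirHypergraph (Node H.edgeSet) (Option H.vertexSet) where
  tail
    | some _ => {Node.source}
    | none => Set.range Node.edge
  head
    | some v => Node.edge '' {e | (v : α) ∈ (e : Set α)}
    | none => {Node.sink}
  disjoint a := by
    cases a <;> simp

/-- The set of hyperarcs `{({s}, E_v) | v ∈ T} ∪ {(E, {t})}` of `toDir H`. -/
def pathOf {α : Type*} (H : Hypergraph α) (T : Set α) : Set (Option H.vertexSet) :=
  insert none (some '' {v | (v : α) ∈ T})

/-! ## Random access machines -/

/-- A memory state: registers and arrays, all of them holding natural numbers. A program mentions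
only finitely many registers and arrays; the arrays are unbounded. -/
structure RAMState where
  reg : ℕ → ℕ
  arr : ℕ → ℕ → ℕ

/-- Programs of a random access machine with addition and truncated subtraction. The arguments
`x y z i` are register numbers, `a` is an array number. -/
inductive RAMProg
  /-- do nothing -/
  | skip
  /-- `x := c` -/
  | const (x c : ℕ)
  /-- `x := y + z` -/
  | add (x y z : ℕ)
  /-- `x := y - z` (truncated at `0`) -/
  | sub (x y z : ℕ)
  /-- `x := a[i]` -/
  | load (x a i : ℕ)
  /-- `a[i] := x` -/
  | store (a i x : ℕ)
  /-- first `p`, then `q` -/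
  | seq (p q : RAMProg)
  /-- if `x ≠ 0` then `p` else `q` -/
  | ite (x : ℕ) (p q : RAMProg)
  /-- while `x ≠ 0` do `p` -/
  | loop (x : ℕ) (p : RAMProg)

namespace RAMState

/-- The state after writing `c` to the register `x`. -/
def setReg (σ : RAMState) (x c : ℕ) : RAMState :=
  { σ with reg := Function.update σ.reg x c }

/-- The state after writing `c` to the cell `j` of the array `a`. -/
def setArr (σ : RAMState) (a j c : ℕ) : RAMState :=
  { σ with arr := Function.update σ.arr a (Function.update (σ.arr a) j c) }

/-- The initial state on the input `w`: array `0` holds `w`, register `0` holds its length,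
and everything else is `0`. -/
def init (w : List ℕ) : RAMState where
  reg := Function.update (fun _ => 0) 0 w.length
  arr := Function.update (fun _ _ => 0) 0 fun j => w.getD j 0

/-- The output held by a state: the first `r` cells of array `1`, where `r` is the content of
register `1`. -/
def output (σ : RAMState) : List ℕ := (List.range (σ.reg 1)).map (σ.arr 1)

end RAMState

/-- `p.Exec σ σ' k`: started in the state `σ`, the program `p` halts in the state `σ'` after
exactly `k` steps. Each elementary instruction and each test of a condition is one step. -/
inductive RAMProg.Exec : RAMProg → RAMState → RAMState → ℕ → Prop
  | skip (σ : RAMState) : Exec .skip σ σ 1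
  | const (σ : RAMState) (x c : ℕ) : Exec (.const x c) σ (σ.setReg x c) 1
  | add (σ : RAMState) (x y z : ℕ) : Exec (.add x y z) σ (σ.setReg x (σ.reg y + σ.reg z)) 1
  | sub (σ : RAMState) (x y z : ℕ) : Exec (.sub x y z) σ (σ.setReg x (σ.reg y - σ.reg z)) 1
  | load (σ : RAMState) (x a i : ℕ) : Exec (.load x a i) σ (σ.setReg x (σ.arr a (σ.reg i))) 1
  | store (σ : RAMState) (a i x : ℕ) :
      Exec (.store a i x) σ (σ.setArr a (σ.reg i) (σ.reg x)) 1
  | seq {p q : RAMProg} {σ σ' σ'' : RAMState} {k l : ℕ} (hp : Exec p σ σ' k)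
      (hq : Exec q σ' σ'' l) : Exec (.seq p q) σ σ'' (k + l)
  | ite_true {x : ℕ} {p q : RAMProg} {σ σ' : RAMState} {k : ℕ} (hx : σ.reg x ≠ 0)
      (hp : Exec p σ σ' k) : Exec (.ite x p q) σ σ' (k + 1)
  | ite_false {x : ℕ} {p q : RAMProg} {σ σ' : RAMState} {k : ℕ} (hx : σ.reg x = 0)
      (hq : Exec q σ σ' k) : Exec (.ite x p q) σ σ' (k + 1)
  | loop_done {x : ℕ} {p : RAMProg} {σ : RAMState} (hx : σ.reg x = 0) :
      Exec (.loop x p) σ σ 1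
  | loop_step {x : ℕ} {p : RAMProg} {σ σ' σ'' : RAMState} {k l : ℕ} (hx : σ.reg x ≠ 0)
      (hp : Exec p σ σ' k) (hl : Exec (.loop x p) σ' σ'' l) :
      Exec (.loop x p) σ σ'' (k + l + 1)

/-- On the input `w`, the program `p` halts within `k` steps with the output `o`. -/
def RAMProg.Computes (p : RAMProg) (w o : List ℕ) (k : ℕ) : Prop :=
  ∃ σ : RAMState, ∃ k' ≤ k, p.Exec (RAMState.init w) σ k' ∧ σ.output = o

/-! ## Codes of hypergraphs and of directed hypergraphs -/

/-- A list of numbers, preceded by its length. -/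
def block (l : List ℕ) : List ℕ := l.length :: l

/-- The set of the entries of a list. -/
def entries (l : List ℕ) : Set ℕ := {x | x ∈ l}

/-- The concatenation of the blocks of `L` describes the family `F` of finite sets of natural
numbers: `L` has one entry for each member of `F`, in any order, and this entry lists the elements
of the member, each of them once, in any order. -/
def ListsFamily (L : List (List ℕ)) (F : Set (Set ℕ)) : Prop :=
  (∀ l ∈ L, l.Nodup) ∧ (L.map entries).Nodup ∧ ∀ X, X ∈ L.map entries ↔ X ∈ F

/-- `w` describes the hypergraph `H` with vertices `0, …, n - 1`: the number of vertices, the number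
of hyperedges, and then, for one hyperedge after the other, its number of elements and its
elements. -/
def IsHypergraphCode (n : ℕ) (H : Hypergraph ℕ) (w : List ℕ) : Prop :=
  ∃ L : List (List ℕ), ListsFamily L H.edgeSet ∧ w = n :: L.length :: (L.map block).flatten

/-- `l` lists the numbers of the elements of `S` under the numbering `e`, each of them once, in any
order. -/
def Lists {V : Type*} {n : ℕ} (e : V ≃ Fin n) (l : List ℕ) (S : Set V) : Prop :=
  l.Nodup ∧ ∀ x, x ∈ l ↔ ∃ v ∈ S, (e v : ℕ) = x

/-- `w` describes `D` with the vertices `s` and `t`, under the numberings `eV` of the vertices and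
`eA` of the hyperarcs: the number of vertices, the number of hyperarcs, the numbers of `s` and `t`,
and then, for one hyperarc after the other, its tail and its head (each as its number of elements
and its elements in any order). -/
def DirHypergraph.IsCode {V A : Type*} {n m : ℕ} (D : DirHypergraph V A) (eV : V ≃ Fin n)
    (eA : A ≃ Fin m) (s t : V) (w : List ℕ) : Prop :=
  ∃ T U : Fin m → List ℕ,
    (∀ a, Lists eV (T (eA a)) (D.tail a)) ∧ (∀ a, Lists eV (U (eA a)) (D.head a)) ∧
    w = n :: m :: (eV s : ℕ) :: (eV t : ℕ) ::
      (List.ofFn fun j => block (T j) ++ block (U j)).flatten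

/-! ## Enumeration problems -/

/-- An enumeration problem: instances, their codes and their sizes, and the set of solutions of
each instance, where a solution is a set of natural numbers. -/
structure EnumProblem where
  Inst : Type
  IsCode : Inst → List ℕ → Prop
  size : Inst → ℕ
  solutions : Inst → Set (Set ℕ)

/-- There is an output-polynomial time algorithm: one program and one polynomial `q` such that, on
every code of every instance of size `k` with `N` solutions, the program halts within `q (k + N)`
steps and outputs the solutions one after the other, in any order, each of them once. -/
def EnumProblem.OutputPolynomial (Q : EnumProblem) : Prop :=
  ∃ (p : RAMProg) (q : Polynomial ℕ), ∀ (I : Q.Inst) (w : List ℕ), Q.IsCode I w →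
    ∃ L : List (List ℕ), ListsFamily L (Q.solutions I) ∧
      p.Computes w (L.map block).flatten (q.eval (Q.size I + (Q.solutions I).ncard))

/-- An instance of minimal transversal enumeration: a finite hypergraph, with vertices
`0, …, n - 1`. -/
structure TransversalInst where
  n : ℕ
  H : Hypergraph ℕ
  vertexSet_eq : H.vertexSet = Set.Iio n

/-- Minimal transversal enumeration. -/
noncomputable def minTransversalEnum : EnumProblem where
  Inst := TransversalInst
  IsCode I w := IsHypergraphCode I.n I.H w
  size I := hypergraphSize I.H
  solutions I := {U | IsMinimalTransversal I.H U}

/-- An instance of `s`-`t` hyperpath enumeration on `BF`-hypergraphs: a finite directed hypergraph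
without parallel hyperarcs, with vertices `0, …, n - 1` and hyperarcs numbered `0, …, m - 1`, all of
them `B`-hyperarcs or `F`-hyperarcs, and two of its vertices. -/
structure HyperpathInst where
  n : ℕ
  m : ℕ
  D : DirHypergraph (Fin n) (Fin m)
  simple : D.IsSimple
  bf : D.IsBF
  s : Fin n
  t : Fin n

/-- The `s`-`t` hyperpath enumeration problem on `BF`-hypergraphs; a hyperpath is output as the set
of the numbers of its hyperarcs. -/
noncomputable def hyperpathEnumBF : EnumProblem where
  Inst := HyperpathInst
  IsCode I w := I.D.IsCode (Equiv.refl _) (Equiv.refl _) I.s I.t w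
  size I := I.D.size
  solutions I := (fun P => (fun a : Fin I.m => (a : ℕ)) '' P) '' {P | I.D.IsHyperpath I.s I.t P}

end HyperEnum

open HyperEnum

/-! To reach `t`, a set of hyperarcs must contain the last hyperarc, and every hyperedge node in its
tail must be reached. The only way to reach the node of `e` is a hyperarc `A_v` with `v ∈ e`, and
every `A_v` can be used at once because its tail is `{s}`. So the sets of hyperarcs connecting `s`
to `t` are exactly the sets `{A_v : v ∈ T} ∪ {A_t}` with `T` a transversal. This correspondence
preserves and reflects inclusion, hence it matches minimal elements (`bijOn_arcsOf`). The argument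
needs only the properties collected in `TransversalNetwork`, so it also applies to modified versions
of the directed hypergraph.

For linear time, the program transposes the incidence relation: one pass over the input builds the
incidence list of each vertex as a linked list, and a second pass prints the lists. The lists have
total length at most the sum of the hyperedge sizes, and since hyperedges are distinct, at most one
is empty, so their number is at most `‖H‖ + 1` (`buildDir_runs_linear`).

For the reduction, `D_H` itself may have parallel hyperarcs. Giving each `A_v` a private additional
head vertex, which lies in no tail, makes the directed hypergraph simple and leaves the reachability
of `t` unchanged (`paddedDir_isSimple`, `solutions_paddedInst`). Its size is quadratically bounded
and it has as many hyperpaths as `H` has minimal transversals. The combined program builds it, runs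
the given enumerator on disjoint working memory (`Exec.rename`), and deletes the number of the last
hyperarc from every hyperpath (`translate_runs`). -/

namespace HyperEnum

/-! ### Hyperpaths and minimal transversals -/

section Hyperpaths

variable {α V A : Type*}

/-- `D` has one hyperarc from `s` for each vertex of `H`, leading to the nodes of the hyperedges
that contain it (and possibly to further vertices), and one hyperarc from all these nodes to `t`. -/
structure TransversalNetwork (H : Hypergraph α) (D : DirHypergraph V A) (s t : V)
    (node : H.edgeSet → V) (arc : H.vertexSet → A) (last : A) : Prop where
  arc_injective : Function.Injective arc
  arc_ne_last : ∀ v, arc v ≠ last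
  eq_arc_or_eq_last : ∀ a, (∃ v, a = arc v) ∨ a = last
  tail_arc : ∀ v, D.tail (arc v) = {s}
  node_mem_head_arc : ∀ v e, node e ∈ D.head (arc v) ↔ (v : α) ∈ (e : Set α)
  target_notMem_head_arc : ∀ v, t ∉ D.head (arc v)
  tail_last : D.tail last = Set.range node
  head_last : D.head last = {t}
  node_ne_source : ∀ e, node e ≠ s
  node_ne_target : ∀ e, node e ≠ t
  source_ne_target : s ≠ t

/-- The hyperarcs of the vertices in `T`, and the last hyperarc. -/
def arcsOf {H : Hypergraph α} (arc : H.vertexSet → A) (last : A) (T : Set α) : Set A :=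
  insert last (arc '' {v | (v : α) ∈ T})

namespace TransversalNetwork

variable {H : Hypergraph α} {D : DirHypergraph V A} {s t : V} {node : H.edgeSet → V}
  {arc : H.vertexSet → A} {last : A}

/-- The distinctness of `s`, `t` and the nodes leaves a single kind of hyperarc that can produce
each of them, so a derivation of `t` can be read backwards. -/
theorem bConnected_iff (h : TransversalNetwork H D s t node arc last) {P : Set A} :
    D.BConnected P s t ↔
      last ∈ P ∧ ∀ e : H.edgeSet, ∃ v : H.vertexSet, arc v ∈ P ∧ (v : α) ∈ (e : Set α) := by
  constructor
  · intro hP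
    -- Nodes and `t` are treated in one induction: when `last` produces `t`, the claim for all nodes
    -- in its tail is needed.
    have key : ∀ x, D.BConnected P s x →
        (∀ e, x = node e → ∃ v : H.vertexSet, arc v ∈ P ∧ (v : α) ∈ (e : Set α)) ∧
        (x = t → last ∈ P ∧
          ∀ e : H.edgeSet, ∃ v : H.vertexSet, arc v ∈ P ∧ (v : α) ∈ (e : Set α)) := by
      intro x hx
      induction hx with
      | base =>
        exact ⟨fun e he => (h.node_ne_source e he.symm).elim,
          fun ht => (h.source_ne_target ht).elim⟩
      | step a ha htail x hx ih =>
        rcases h.eq_arc_or_eq_last a with ⟨v, rfl⟩ | rfl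
        · refine ⟨fun e he => ⟨v, ha, (h.node_mem_head_arc v e).1 (he ▸ hx)⟩, fun ht => ?_⟩
          exact (h.target_notMem_head_arc v (ht ▸ hx)).elim
        · rw [h.head_last, Set.mem_singleton_iff] at hx
          subst hx
          refine ⟨fun e he => (h.node_ne_target e he.symm).elim, fun _ => ⟨ha, fun e => ?_⟩⟩
          exact (ih (node e) (h.tail_last ▸ Set.mem_range_self e)).1 e rfl
    exact (key t hP).2 rfl
  · rintro ⟨hlast, hP⟩
    refine .step last hlast (fun u hu => ?_) t (by simp [h.head_last])
    rw [h.tail_last] at hu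
    obtain ⟨e, rfl⟩ := hu
    obtain ⟨v, hv, hve⟩ := hP e
    refine .step (arc v) hv (fun u hu => ?_) _ ((h.node_mem_head_arc v e).2 hve)
    rw [h.tail_arc, Set.mem_singleton_iff] at hu
    exact hu ▸ .base

theorem arc_mem_arcsOf (h : TransversalNetwork H D s t node arc last) {v : H.vertexSet}
    {T : Set α} : arc v ∈ arcsOf arc last T ↔ (v : α) ∈ T := by
  simp [arcsOf, h.arc_ne_last, h.arc_injective.eq_iff]

theorem arcsOf_subset_iff (h : TransversalNetwork H D s t node arc last) {T U : Set α}
    (hT : T ⊆ H.vertexSet) : arcsOf arc last T ⊆ arcsOf arc last U ↔ T ⊆ U := by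
  refine ⟨fun hTU x hx => ?_, fun hTU => ?_⟩
  · exact (h.arc_mem_arcsOf (v := ⟨x, hT hx⟩)).1 (hTU (h.arc_mem_arcsOf.2 hx))
  · exact Set.insert_subset_insert (Set.image_mono fun v hv => hTU hv)

theorem bConnected_arcsOf_iff (h : TransversalNetwork H D s t node arc last) {T : Set α}
    (hT : T ⊆ H.vertexSet) : D.BConnected (arcsOf arc last T) s t ↔ IsTransversal H T := by
  simp only [h.bConnected_iff, h.arc_mem_arcsOf, IsTransversal]
  constructor
  · rintro ⟨-, hP⟩
    refine ⟨hT, fun e he => ?_⟩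
    obtain ⟨v, hv, hve⟩ := hP ⟨e, he⟩
    exact ⟨v, hve, hv⟩
  · rintro ⟨-, hP⟩
    refine ⟨Set.mem_insert _ _, fun e => ?_⟩
    obtain ⟨v, hve, hv⟩ := hP e e.2
    exact ⟨⟨v, hT hv⟩, hv, hve⟩

theorem exists_eq_arcsOf (h : TransversalNetwork H D s t node arc last) {P : Set A}
    (hP : last ∈ P) : ∃ T ⊆ H.vertexSet, P = arcsOf arc last T := by
  refine ⟨(↑) '' (arc ⁻¹' P), by rintro _ ⟨v, -, rfl⟩; exact v.2, ?_⟩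
  ext a
  rcases h.eq_arc_or_eq_last a with ⟨v, rfl⟩ | rfl
  · simp [h.arc_mem_arcsOf]
  · simp [hP, arcsOf]

/-- On subsets of the vertex set, `arcsOf` is an order embedding whose range is the family of sets
containing `last`. All connecting sets lie in this range, so minimality transfers in both
directions. -/
theorem bijOn_arcsOf (h : TransversalNetwork H D s t node arc last) :
    Set.BijOn (arcsOf arc last) {T | IsMinimalTransversal H T} {P | D.IsHyperpath s t P} := by
  refine ⟨fun T hT => ⟨?_, fun Q hQ hQT => ?_⟩, fun T hT U hU hTU => ?_, fun P hP => ?_⟩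
  · exact (h.bConnected_arcsOf_iff hT.1.1).2 hT.1
  · obtain ⟨U, hU, rfl⟩ := h.exists_eq_arcsOf (h.bConnected_iff.1 hQ).1
    exact (h.arcsOf_subset_iff hT.1.1).2
      (hT.2 ((h.bConnected_arcsOf_iff hU).1 hQ) ((h.arcsOf_subset_iff hU).1 hQT))
  · exact ((h.arcsOf_subset_iff hT.1.1).1 hTU.subset).antisymm
      ((h.arcsOf_subset_iff hU.1.1).1 hTU.symm.subset)
  · obtain ⟨T, hT, rfl⟩ := h.exists_eq_arcsOf (h.bConnected_iff.1 hP.1).1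
    refine ⟨T, ⟨(h.bConnected_arcsOf_iff hT).1 hP.1, fun U hU hUT => ?_⟩, rfl⟩
    exact (h.arcsOf_subset_iff hT).1 (hP.2 ((h.bConnected_arcsOf_iff hU.1).2 hU)
      ((h.arcsOf_subset_iff hU.1).2 hUT))

end TransversalNetwork

theorem transversalNetwork_toDir (H : Hypergraph α) :
    TransversalNetwork H (toDir H) Node.source Node.sink Node.edge some none where
  arc_injective := Option.some_injective _
  arc_ne_last _ := by simp
  eq_arc_or_eq_last a := by cases a <;> simp
  tail_arc _ := rfl
  node_mem_head_arc v e := by simp [toDir]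
  target_notMem_head_arc v := by simp [toDir]
  tail_last := rfl
  head_last := rfl
  node_ne_source _ := by simp
  node_ne_target _ := by simp
  source_ne_target := by simp

theorem toDir_isBF (H : Hypergraph α) : (toDir H).IsBF := by
  rintro (_ | v) <;> simp [toDir]

theorem toDir_isSimple_iff (H : Hypergraph α) :
    (toDir H).IsSimple ↔ ∀ u ∈ H.vertexSet, ∀ v ∈ H.vertexSet,
      (∀ e ∈ H.edgeSet, u ∈ e ↔ v ∈ e) → u = v := by
  have head_iff : ∀ (v : H.vertexSet) (e : H.edgeSet),
      Node.edge e ∈ (toDir H).head (some v) ↔ (v : α) ∈ (e : Set α) :=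
    (transversalNetwork_toDir H).node_mem_head_arc
  constructor
  · intro hs u hu v hv huv
    have : (some ⟨u, hu⟩ : Option H.vertexSet) = some ⟨v, hv⟩ := by
      apply hs
      have : {e : H.edgeSet | u ∈ (e : Set α)} = {e : H.edgeSet | v ∈ (e : Set α)} := by
        ext e
        exact huv e e.2
      simp [toDir, this]
    simpa using this
  · rintro hs (_ | u) (_ | v) huv
    · rfl
    -- The source is in the tail of every `some v` and not in that of `none`.
    · have := congrArg (fun p => Node.source ∈ p.1) huv
      simp [toDir] at this
    · have := congrArg (fun p => Node.source ∈ p.1) huv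
      simp [toDir] at this
    · refine congrArg some (Subtype.ext (hs u u.2 v v.2 fun e he => ?_))
      have := congrArg Prod.snd huv
      simp only at this
      rw [← head_iff u ⟨e, he⟩, ← head_iff v ⟨e, he⟩, this]

end Hyperpaths

/-! ### Running times, memory footprints and renaming of machine programs -/

section Machines

namespace RAMProg

/-- Started in `σ`, the program `p` halts within `k` steps in a state that satisfies `Q`. -/
def Runs (p : RAMProg) (σ : RAMState) (k : ℕ) (Q : RAMState → Prop) : Prop :=
  ∃ τ : RAMState, ∃ k' ≤ k, p.Exec σ τ k' ∧ Q τ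

theorem Runs.mono {p : RAMProg} {σ : RAMState} {k l : ℕ} {Q R : RAMState → Prop}
    (h : p.Runs σ k Q) (hkl : k ≤ l) (hQR : ∀ τ, Q τ → R τ) : p.Runs σ l R := by
  obtain ⟨τ, k', hk, he, hQ⟩ := h
  exact ⟨τ, k', hk.trans hkl, he, hQR τ hQ⟩

theorem Runs.seq {p q : RAMProg} {σ : RAMState} {k l : ℕ} {Q R : RAMState → Prop}
    (hp : p.Runs σ k Q) (hq : ∀ τ, Q τ → q.Runs τ l R) : (p.seq q).Runs σ (k + l) R := by
  obtain ⟨τ, k', hk, he, hQ⟩ := hp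
  obtain ⟨υ, l', hl, he', hR⟩ := hq τ hQ
  exact ⟨υ, k' + l', by omega, he.seq he', hR⟩

theorem Runs.loop_done {p : RAMProg} {σ : RAMState} {x : ℕ} {Q : RAMState → Prop}
    (hx : σ.reg x = 0) (hQ : Q σ) : (loop x p).Runs σ 1 Q :=
  ⟨σ, 1, le_rfl, .loop_done hx, hQ⟩

theorem Runs.loop_step {p : RAMProg} {σ : RAMState} {x k l : ℕ} {Q R : RAMState → Prop}
    (hx : σ.reg x ≠ 0) (hp : p.Runs σ k Q) (hl : ∀ τ, Q τ → (loop x p).Runs τ l R) :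
    (loop x p).Runs σ (k + l + 1) R := by
  obtain ⟨τ, k', hk, he, hQ⟩ := hp
  obtain ⟨υ, l', hl, he', hR⟩ := hl τ hQ
  exact ⟨υ, k' + l' + 1, by omega, .loop_step hx he he', hR⟩

theorem Runs.ite_true {p q : RAMProg} {σ : RAMState} {x k : ℕ} {Q : RAMState → Prop}
    (hx : σ.reg x ≠ 0) (hp : p.Runs σ k Q) : (ite x p q).Runs σ (k + 1) Q := by
  obtain ⟨τ, k', hk, he, hQ⟩ := hp
  exact ⟨τ, k' + 1, by omega, .ite_true hx he, hQ⟩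

theorem Runs.ite_false {p q : RAMProg} {σ : RAMState} {x k : ℕ} {Q : RAMState → Prop}
    (hx : σ.reg x = 0) (hq : q.Runs σ k Q) : (ite x p q).Runs σ (k + 1) Q := by
  obtain ⟨τ, k', hk, he, hQ⟩ := hq
  exact ⟨τ, k' + 1, by omega, .ite_false hx he, hQ⟩

/-- The effect of a program without tests. -/
def straightRun : RAMProg → RAMState → RAMState
  | const x c, σ => σ.setReg x c
  | add x y z, σ => σ.setReg x (σ.reg y + σ.reg z)
  | sub x y z, σ => σ.setReg x (σ.reg y - σ.reg z)
  | load x a i, σ => σ.setReg x (σ.arr a (σ.reg i))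
  | store a i x, σ => σ.setArr a (σ.reg i) (σ.reg x)
  | seq p q, σ => q.straightRun (p.straightRun σ)
  | _, σ => σ

/-- The number of steps of a program without tests. -/
def straightCost : RAMProg → ℕ
  | seq p q => p.straightCost + q.straightCost
  | _ => 1

/-- The program has no tests. -/
def IsStraight : RAMProg → Prop
  | seq p q => p.IsStraight ∧ q.IsStraight
  | ite _ _ _ => False
  | loop _ _ => False
  | _ => True

theorem IsStraight.exec {p : RAMProg} (hp : p.IsStraight) (σ : RAMState) :
    p.Exec σ (p.straightRun σ) p.straightCost := by
  induction p generalizing σ with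
  | seq p q ihp ihq => exact (ihp hp.1 σ).seq (ihq hp.2 _)
  | ite => exact hp.elim
  | loop => exact hp.elim
  | _ => constructor

/-- Reduces the verification of a program without tests to a computation of its final state, which
`simp` can carry out. -/
theorem IsStraight.runs {p : RAMProg} (hp : p.IsStraight) {σ : RAMState} {Q : RAMState → Prop}
    (hQ : Q (p.straightRun σ)) : p.Runs σ p.straightCost Q :=
  ⟨_, _, le_rfl, hp.exec σ, hQ⟩

/-- The program writes to registers below `r` and to arrays below `a` only. -/
def WritesBelow (r a : ℕ) : RAMProg → Prop
  | skip => True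
  | const x _ => x < r
  | add x _ _ => x < r
  | sub x _ _ => x < r
  | load x _ _ => x < r
  | store b _ _ => b < a
  | seq p q => p.WritesBelow r a ∧ q.WritesBelow r a
  | ite _ p q => p.WritesBelow r a ∧ q.WritesBelow r a
  | loop _ p => p.WritesBelow r a

/-- Together with `Exec.arr_eq`, this shows that memory beyond the footprint of one program is still
untouched when another one is started after it. -/
theorem Exec.reg_eq {p : RAMProg} {σ τ : RAMState} {k r a : ℕ} (he : p.Exec σ τ k)
    (hp : p.WritesBelow r a) {x : ℕ} (hx : r ≤ x) : τ.reg x = σ.reg x := by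
  have hne : ∀ {y}, y < r → x ≠ y := fun hy => by omega
  induction he with
  | skip | store | loop_done => rfl
  | const | add | sub | load => exact Function.update_of_ne (hne hp) _ _
  | seq _ _ ihp ihq => rw [ihq hp.2, ihp hp.1]
  | ite_true _ _ ih => exact ih hp.1
  | ite_false _ _ ih => exact ih hp.2
  | loop_step _ _ _ ihp ihl => rw [ihl hp, ihp hp]

theorem Exec.arr_eq {p : RAMProg} {σ τ : RAMState} {k r a : ℕ} (he : p.Exec σ τ k)
    (hp : p.WritesBelow r a) {b : ℕ} (hb : a ≤ b) : τ.arr b = σ.arr b := by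
  have hne : ∀ {c}, c < a → b ≠ c := fun hc => by omega
  induction he with
  | skip | loop_done | const | add | sub | load => rfl
  | store => exact Function.update_of_ne (hne hp) _ _
  | seq _ _ ihp ihq => rw [ihq hp.2, ihp hp.1]
  | ite_true _ _ ih => exact ih hp.1
  | ite_false _ _ ih => exact ih hp.2
  | loop_step _ _ _ ihp ihl => rw [ihl hp, ihp hp]

/-- The program with its registers renamed by `f` and its arrays renamed by `g`. -/
def rename (f g : ℕ → ℕ) : RAMProg → RAMProg
  | skip => skip
  | const x c => const (f x) c
  | add x y z => add (f x) (f y) (f z)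
  | sub x y z => sub (f x) (f y) (f z)
  | load x a i => load (f x) (g a) (f i)
  | store a i x => store (g a) (f i) (f x)
  | seq p q => seq (p.rename f g) (q.rename f g)
  | ite x p q => ite (f x) (p.rename f g) (q.rename f g)
  | loop x p => loop (f x) (p.rename f g)

/-- Running a program inside another one: only the renamed part of the memory has to look like the
original memory. The last clause lets data of the surrounding program survive in the other arrays.
-/
theorem Exec.rename {p : RAMProg} {σ τ : RAMState} {k : ℕ} (he : p.Exec σ τ k) {f g : ℕ → ℕ}
    (hf : Function.Injective f) (hg : Function.Injective g) {σ' : RAMState}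
    (hreg : ∀ x, σ'.reg (f x) = σ.reg x) (harr : ∀ a, σ'.arr (g a) = σ.arr a) :
    ∃ τ' : RAMState, (p.rename f g).Exec σ' τ' k ∧ (∀ x, τ'.reg (f x) = τ.reg x) ∧
      (∀ a, τ'.arr (g a) = τ.arr a) ∧ ∀ b ∉ Set.range g, τ'.arr b = σ'.arr b := by
  have set_reg : ∀ {σ σ' : RAMState} (x c c' : ℕ), c' = c → (∀ x, σ'.reg (f x) = σ.reg x) →
      ∀ y, (σ'.setReg (f x) c').reg (f y) = (σ.setReg x c).reg y := by
    rintro σ σ' x c c' rfl h y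
    simp [RAMState.setReg, Function.update_apply, hf.eq_iff, h]
  induction he generalizing σ' with
  | skip => exact ⟨σ', .skip _, hreg, harr, fun _ _ => rfl⟩
  | const _ x c => exact ⟨_, .const _ _ _, set_reg x _ _ rfl hreg, harr, fun _ _ => rfl⟩
  | add _ x => exact ⟨_, .add _ _ _ _, set_reg x _ _ (by simp [hreg]) hreg, harr, fun _ _ => rfl⟩
  | sub _ x => exact ⟨_, .sub _ _ _ _, set_reg x _ _ (by simp [hreg]) hreg, harr, fun _ _ => rfl⟩
  | load _ x =>
    exact ⟨_, .load _ _ _ _, set_reg x _ _ (by simp [hreg, harr]) hreg, harr, fun _ _ => rfl⟩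
  | store _ a i x =>
    refine ⟨_, .store _ _ _ _, hreg, fun b => ?_, fun b hb => ?_⟩
    · simp [RAMState.setArr, Function.update_apply, hg.eq_iff, hreg, harr]
    · exact Function.update_of_ne (fun h => hb ⟨a, h.symm⟩) _ _
  | seq _ _ ihp ihq =>
    obtain ⟨τ₁, h₁, hr₁, ha₁, hb₁⟩ := ihp hreg harr
    obtain ⟨τ₂, h₂, hr₂, ha₂, hb₂⟩ := ihq hr₁ ha₁
    exact ⟨τ₂, h₁.seq h₂, hr₂, ha₂, fun b hb => (hb₂ b hb).trans (hb₁ b hb)⟩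
  | ite_true hx _ ih =>
    obtain ⟨τ, h, hr, ha, hb⟩ := ih hreg harr
    exact ⟨τ, .ite_true (by rwa [hreg]) h, hr, ha, hb⟩
  | ite_false hx _ ih =>
    obtain ⟨τ, h, hr, ha, hb⟩ := ih hreg harr
    exact ⟨τ, .ite_false (by rwa [hreg]) h, hr, ha, hb⟩
  | loop_done hx => exact ⟨σ', .loop_done (by rwa [hreg]), hreg, harr, fun _ _ => rfl⟩
  | loop_step hx _ _ ihp ihl =>
    obtain ⟨τ₁, h₁, hr₁, ha₁, hb₁⟩ := ihp hreg harr
    obtain ⟨τ₂, h₂, hr₂, ha₂, hb₂⟩ := ihl hr₁ ha₁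
    exact ⟨τ₂, .loop_step (by rwa [hreg]) h₁ h₂, hr₂, ha₂, fun b hb => (hb₂ b hb).trans (hb₁ b hb)⟩

end RAMProg

/-- The function that agrees with the list `l` as far as `l` reaches, and with `z` beyond. -/
def overlay (l : List ℕ) (z : ℕ → ℕ) (j : ℕ) : ℕ := l.getD j (z j)

/-- Writing one cell behind the list is appending. The contents `z` beyond it are arbitrary, so
memory need not be cleared before it is reused for output. -/
theorem update_overlay (l : List ℕ) (z : ℕ → ℕ) (x : ℕ) :
    Function.update (overlay l z) l.length x = overlay (l ++ [x]) z := by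
  ext j
  rcases lt_trichotomy j l.length with h | rfl | h
  · simp [overlay, h.ne, List.getElem?_append_left h]
  · simp [overlay]
  · have : (l ++ [x]).length ≤ j := by simp; omega
    simp [overlay, h.ne', List.getElem?_eq_none this,
      List.getElem?_eq_none h.le]

theorem overlay_append_cons (l r : List ℕ) (x : ℕ) (z : ℕ → ℕ) :
    overlay (l ++ x :: r) z l.length = x := by
  simp [overlay]

theorem RAMState.output_eq {σ : RAMState} {o : List ℕ} {z : ℕ → ℕ} (hl : σ.reg 1 = o.length)
    (ho : σ.arr 1 = overlay o z) : σ.output = o := by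
  refine List.ext_getElem (by simp [RAMState.output, hl]) fun j h₁ h₂ => ?_
  simp [RAMState.output, ho, overlay, h₂]

theorem RAMState.arr_one_eq_overlay (σ : RAMState) :
    σ.arr 1 = overlay σ.output (σ.arr 1) := by
  ext j
  by_cases h : j < σ.reg 1 <;> simp [overlay, RAMState.output, h]

end Machines

/-! ### Reading a hypergraph into linked incidence lists -/

section Construction

local infixr:60 " ⨟ " => RAMProg.seq

/-- In the linked list with links `N` and entries `E`, the entries from the cell `p` on are `l`;
all cells are positive and below `b`, and the link `0` ends the list. -/
def Chain (N E : ℕ → ℕ) (b : ℕ) : ℕ → List ℕ → Prop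
  | p, [] => p = 0
  | p, x :: l => p ≠ 0 ∧ p < b ∧ E p = x ∧ Chain N E b (N p) l

theorem Chain.update {N E : ℕ → ℕ} {b p : ℕ} {l : List ℕ} (h : Chain N E b p l) (x y : ℕ) :
    Chain (Function.update N b x) (Function.update E b y) (b + 1) p l := by
  induction l generalizing p with
  | nil => exact h
  | cons z l ih =>
    obtain ⟨h0, hb, hE, h⟩ := h
    refine ⟨h0, by omega, by rwa [Function.update_of_ne hb.ne], ?_⟩
    rw [Function.update_of_ne hb.ne]
    exact ih h

/-- The cell `b` is fresh for every list, because all of them use cells below `b`; so linking it in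
front of the list of `v` disturbs none. It must not be `0`, which marks the end of a list. -/
theorem Chain.insert {N E h : ℕ → ℕ} {b : ℕ} {f : ℕ → List ℕ}
    (hc : ∀ v, Chain N E b (h v) (f v)) (hb : b ≠ 0) (v e : ℕ) (u : ℕ) :
    Chain (Function.update N b (h v)) (Function.update E b e) (b + 1)
      (Function.update h v b u) (Function.update f v (e :: f v) u) := by
  by_cases huv : u = v
  · subst huv
    simpa [Chain, hb] using (hc u).update (h u) e
  · rw [Function.update_of_ne huv, Function.update_of_ne huv]
    exact (hc u).update _ _

/-- The incidence lists `f` after reading the edge with the number `e` and the elements `l`. -/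
def insertEdge (e : ℕ) (l : List ℕ) (f : ℕ → List ℕ) : ℕ → List ℕ :=
  l.foldl (fun g v => Function.update g v (e :: g v)) f

/-- The incidence lists `f` after reading the edges `L`, numbered from `e` on. -/
def insertEdges : ℕ → List (List ℕ) → (ℕ → List ℕ) → ℕ → List ℕ
  | _, [], f => f
  | e, l :: L, f => insertEdges (e + 1) L (insertEdge e l f)

theorem insertEdge_apply {e : ℕ} {l : List ℕ} (hl : l.Nodup) (f : ℕ → List ℕ) (v : ℕ) :
    insertEdge e l f v = if v ∈ l then e :: f v else f v := by
  induction l generalizing f with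
  | nil => simp [insertEdge]
  | cons x l ih =>
    rw [List.nodup_cons] at hl
    rw [insertEdge, List.foldl_cons]
    refine (ih hl.2 _).trans ?_
    by_cases hvx : v = x
    · subst hvx; simp [hl.1]
    · simp [hvx]

theorem mem_insertEdges {e : ℕ} {L : List (List ℕ)} (hL : ∀ l ∈ L, l.Nodup) (f : ℕ → List ℕ)
    (v x : ℕ) :
    x ∈ insertEdges e L f v ↔ x ∈ f v ∨ ∃ i, ∃ h : i < L.length, v ∈ L[i] ∧ x = e + i := by
  induction L generalizing e f with
  | nil => simp [insertEdges]
  | cons l L ih =>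
    rw [List.forall_mem_cons] at hL
    rw [insertEdges, ih hL.2, insertEdge_apply hL.1]
    constructor
    · rintro (h | ⟨i, hi, hv, rfl⟩)
      · split_ifs at h with hv
        · rcases List.mem_cons.1 h with rfl | h
          · exact .inr ⟨0, by simp, by simpa, by simp⟩
          · exact .inl h
        · exact .inl h
      · exact .inr ⟨i + 1, by simpa, by simpa, by omega⟩
    · rintro (h | ⟨i, hi, hv, rfl⟩)
      · left; split_ifs <;> simp [h]
      · cases i with
        | zero => left; simp at hv; simp [hv]
        | succ i => exact .inr ⟨i, by simpa using hi, by simpa using hv, by omega⟩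

/-- The invariant is that all recorded numbers are below the number `e` of the next hyperedge, so
prepending `e` creates no repetition. -/
theorem nodup_insertEdges {e : ℕ} {L : List (List ℕ)} (hL : ∀ l ∈ L, l.Nodup) (f : ℕ → List ℕ)
    (hf : ∀ v, (f v).Nodup ∧ ∀ x ∈ f v, x < e) (v : ℕ) : (insertEdges e L f v).Nodup := by
  induction L generalizing e f with
  | nil => exact (hf v).1
  | cons l L ih =>
    rw [List.forall_mem_cons] at hL
    refine ih hL.2 _ fun u => ?_
    rw [insertEdge_apply hL.1]
    split_ifs
    · refine ⟨List.nodup_cons.2 ⟨fun h => lt_irrefl e ((hf u).2 e h), (hf u).1⟩, ?_⟩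
      rintro x hx
      rcases List.mem_cons.1 hx with rfl | hx
      · omega
      · exact ((hf u).2 x hx).trans (Nat.lt_succ_self e)
    · exact ⟨(hf u).1, fun x hx => ((hf u).2 x hx).trans (Nat.lt_succ_self e)⟩

theorem update_overlay_of_eq {l : List ℕ} {z : ℕ → ℕ} {i : ℕ} (x : ℕ) (hi : i = l.length) :
    Function.update (overlay l z) i x = overlay (l ++ [x]) z :=
  hi ▸ update_overlay l z x

open RAMProg

/-- Appends the content of the register `x` to the output, if the register `2` holds `1`. -/
def emit (x : ℕ) : RAMProg := store 1 1 x ⨟ add 1 1 2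

/-- The program `p`, if `b` is true. -/
def onlyIf (b : Bool) (p : RAMProg) : RAMProg := if b then p else skip

/-- The situation while the directed hypergraph is built. Register `1` holds the length of the
output, register `2` holds `1`, the registers `3`, `4` the numbers of vertices and hyperedges, and
register `5` the reading position. The incidence list of `v` is a linked list that
starts at the cell `σ.arr 2 v`; its length is `σ.arr 5 v`. -/
structure BuildState (w : List ℕ) (n m pos : ℕ) (f : ℕ → List ℕ) (o : List ℕ) (σ : RAMState) :
    Prop where
  input : σ.arr 0 = overlay w fun _ => 0
  out : σ.arr 1 = overlay o fun _ => 0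
  outLength : σ.reg 1 = o.length
  one : σ.reg 2 = 1
  vertices : σ.reg 3 = n
  edges : σ.reg 4 = m
  position : σ.reg 5 = pos
  chain : ∀ v, Chain (σ.arr 3) (σ.arr 4) pos (σ.arr 2 v) (f v)
  degree : ∀ v, σ.arr 5 v = (f v).length

/-- Inserts the current hyperedge into the incidence list of the vertex that is read. -/
def insertEntry : RAMProg :=
  load 9 0 5 ⨟ load 10 2 9 ⨟ store 3 5 10 ⨟ store 2 9 5 ⨟ store 4 5 6 ⨟ load 10 5 9 ⨟
  add 10 10 2 ⨟ store 5 9 10 ⨟ add 5 5 2 ⨟ sub 8 8 2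

/-- The reading position itself serves as the address of the new list cell. Positions increase, so
no cell is used twice, and they are nonzero because the input starts with a header. -/
theorem insertEntry_runs {w o : List ℕ} {n m e v : ℕ} {f : ℕ → List ℕ} {σ : RAMState}
    {pre rest : List ℕ} (hw : w = pre ++ v :: rest) (hpre : pre ≠ [])
    (hσ : BuildState w n m pre.length f o σ) (he : σ.reg 6 = e) :
    insertEntry.Runs σ 10 fun τ =>
      BuildState w n m (pre.length + 1) (Function.update f v (e :: f v)) o τ ∧
      τ.reg 6 = e ∧ τ.reg 7 = σ.reg 7 ∧ τ.reg 8 = σ.reg 8 - 1 := by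
  have hv : overlay w (fun _ => 0) pre.length = v := by rw [hw, overlay_append_cons]
  clear hw
  obtain ⟨h1, h2, h3, h4, h5, h6, h7, h8, h9⟩ := hσ
  have hc := Chain.insert h8 (by simpa using hpre) v e
  refine IsStraight.runs (by simp [insertEntry, IsStraight])
      ⟨⟨?_, ?_, ?_, ?_, ?_, ?_, ?_, ?_, ?_⟩, ?_, ?_, ?_⟩ <;>
    simp [insertEntry, straightRun, RAMState.setReg, RAMState.setArr, *]
  intro u
  by_cases huv : u = v
  · subst huv; simp
  · simp [huv, h9]

theorem loop_insertEntry_runs {w o : List ℕ} {n m e : ℕ} {f : ℕ → List ℕ} {σ : RAMState}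
    {pre l rest : List ℕ} (hw : w = pre ++ (l ++ rest)) (hpre : pre ≠ [])
    (hσ : BuildState w n m pre.length f o σ) (he : σ.reg 6 = e) (hl : σ.reg 8 = l.length) :
    (loop 8 insertEntry).Runs σ (11 * l.length + 1) fun τ =>
      BuildState w n m (pre.length + l.length) (insertEdge e l f) o τ ∧
      τ.reg 6 = e ∧ τ.reg 7 = σ.reg 7 := by
  induction l generalizing σ pre f with
  | nil => exact .loop_done hl ⟨hσ, he, rfl⟩
  | cons v l ih =>
    refine (Runs.loop_step (k := 10) (l := 11 * l.length + 1) (by simp [hl])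
      (insertEntry_runs hw hpre hσ he) ?_).mono (by simp; omega) fun _ h => h
    rintro τ ⟨hτ, h6, h7, h8⟩
    refine (ih (pre := pre ++ [v]) (by simp [hw]) (by simp) (by simpa using hτ) h6
      (by simp [h8, hl])).mono le_rfl ?_
    rintro υ ⟨hυ, h6', h7'⟩
    refine ⟨?_, h6', h7'.trans h7⟩
    change BuildState w n m _ (insertEdge e l (Function.update f v (e :: f v))) o υ
    simpa [add_assoc, add_comm 1] using hυ

/-- Reads a hyperedge. -/
def readEdge : RAMProg :=
  (load 8 0 5 ⨟ add 5 5 2) ⨟ loop 8 insertEntry ⨟ (add 6 6 2 ⨟ sub 7 7 2)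

theorem readEdge_runs {w o : List ℕ} {n m e : ℕ} {f : ℕ → List ℕ} {σ : RAMState}
    {pre l rest : List ℕ} (hw : w = pre ++ (block l ++ rest))
    (hσ : BuildState w n m pre.length f o σ) (he : σ.reg 6 = e) :
    readEdge.Runs σ (11 * l.length + 5) fun τ =>
      BuildState w n m (pre.length + (block l).length) (insertEdge e l f) o τ ∧
      τ.reg 6 = e + 1 ∧ τ.reg 7 = σ.reg 7 - 1 := by
  have hv : overlay w (fun _ => 0) pre.length = l.length := by
    rw [hw, block, List.cons_append, overlay_append_cons]
  refine (Runs.seq (k := 2) (l := 11 * l.length + 3) (Q := fun τ =>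
    BuildState w n m (pre.length + 1) f o τ ∧ τ.reg 6 = e ∧ τ.reg 7 = σ.reg 7 ∧
      τ.reg 8 = l.length) ?_ ?_).mono (by omega) fun _ h => h
  · clear hw
    obtain ⟨h1, h2, h3, h4, h5, h6, h7, h8, h9⟩ := hσ
    refine IsStraight.runs (by simp [IsStraight])
      ⟨⟨?_, ?_, ?_, ?_, ?_, ?_, ?_, ?_, ?_⟩, ?_, ?_, ?_⟩ <;>
      simp [straightRun, RAMState.setReg, *]
    intro v
    -- Reading a length stores no cell, but the bound still moves by one: the skipped cell is
    -- overwritten by its own contents.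
    have := (h8 v).update (σ.arr 3 pre.length) (σ.arr 4 pre.length)
    simpa using this
  · rintro τ ⟨hτ, h6, h7, h8⟩
    refine Runs.seq (k := 11 * l.length + 1) (l := 2)
      (loop_insertEntry_runs (w := w) (pre := pre ++ [l.length]) (l := l) (rest := rest)
        (by simp [hw, block]) (by simp) (by simpa using hτ) h6 h8) ?_
    rintro υ ⟨⟨h1, h2, h3, h4, h5, h6, h7, h8, h9⟩, h10, h11⟩
    refine IsStraight.runs (by simp [IsStraight]) ⟨⟨?_, ?_, ?_, ?_, ?_, ?_, ?_, ?_, ?_⟩, ?_, ?_⟩ <;>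
      simp_all [straightRun, RAMState.setReg, block, add_assoc, add_comm 1]

theorem loop_readEdge_runs {w o : List ℕ} {n m e : ℕ} {f : ℕ → List ℕ} {σ : RAMState}
    {pre : List ℕ} {L : List (List ℕ)} (hw : w = pre ++ (L.map block).flatten)
    (hσ : BuildState w n m pre.length f o σ) (he : σ.reg 6 = e) (hL : σ.reg 7 = L.length) :
    (loop 7 readEdge).Runs σ (11 * (L.map List.length).sum + 6 * L.length + 1)
      (BuildState w n m w.length (insertEdges e L f) o) := by
  induction L generalizing σ pre f e with
  | nil =>
    refine .loop_done hL ?_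
    rw [hw]
    simpa [insertEdges, hw] using hσ
  | cons l L ih =>
    rw [List.map_cons, List.flatten_cons] at hw
    refine (Runs.loop_step (k := 11 * l.length + 5)
      (l := 11 * (L.map List.length).sum + 6 * L.length + 1) (by simp [hL])
      (readEdge_runs hw hσ he) ?_).mono (by simp; omega) fun _ h => h
    rintro τ ⟨hτ, h6, h7⟩
    exact ih (pre := pre ++ block l) (by simp [hw]) (by simpa using hτ) h6 (by simp [h7, hL])

/-- Reads the hypergraph. -/
def readHypergraph : RAMProg :=
  (const 2 1 ⨟ const 5 0 ⨟ load 3 0 5 ⨟ load 4 0 2 ⨟ const 5 2 ⨟ add 7 4 6) ⨟ loop 7 readEdge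

theorem readHypergraph_runs {w : List ℕ} {n : ℕ} {L : List (List ℕ)}
    (hw : w = n :: L.length :: (L.map block).flatten) :
    readHypergraph.Runs (RAMState.init w) (11 * (L.map List.length).sum + 6 * L.length + 7)
      (BuildState w n L.length w.length (insertEdges 0 L fun _ => []) []) := by
  -- Reading starts at position `2`, behind the two header numbers. Register `6` is still `0`, so
  -- adding it copies a register, and it is also the number of the first hyperedge.
  refine (Runs.seq (k := 6) (l := 11 * (L.map List.length).sum + 6 * L.length + 1) (Q := fun τ =>
    BuildState w n L.length [n, L.length].length (fun _ => []) [] τ ∧ τ.reg 6 = 0 ∧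
      τ.reg 7 = L.length) ?_ ?_).mono (by omega) fun _ h => h
  · refine IsStraight.runs (by simp [IsStraight]) ⟨⟨?_, ?_, ?_, ?_, ?_, ?_, ?_, ?_, ?_⟩, ?_, ?_⟩ <;>
      simp [straightRun, RAMState.setReg, RAMState.init, Chain, hw] <;> rfl
  · rintro τ ⟨hτ, h6, h7⟩
    exact loop_readEdge_runs (pre := [n, L.length]) (by simp [hw]) hτ h6 h7

end Construction

/-! ### Printing the code of the directed hypergraph -/

section Construction

local infixr:60 " ⨟ " => RAMProg.seq

open RAMProg

/-- The list of the head of the hyperarc of the vertex `v`: the hyperedges containing `v` and, if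
`b` is true, a further vertex that belongs to this hyperarc only. -/
def headList (b : Bool) (m : ℕ) (f : ℕ → List ℕ) (v : ℕ) : List ℕ :=
  if b then (m + 2 + v) :: f v else f v

/-- The code of the hyperarc of the vertex `v`. -/
def arcCode (b : Bool) (m : ℕ) (f : ℕ → List ℕ) (v : ℕ) : List ℕ :=
  block [m] ++ block (headList b m f v)

/-- The code of the directed hypergraph with the hyperedges `0, …, m - 1`, the source `m` and the
sink `m + 1`, where the vertices `v < n` have the incidence lists `f v`. -/
def dirCode (b : Bool) (n m : ℕ) (f : ℕ → List ℕ) : List ℕ :=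
  (m + 2 + if b then n else 0) :: (n + 1) :: m :: (m + 1) ::
    (((List.range n).map (arcCode b m f)).flatten ++ (block (List.range m) ++ block [m + 1]))

/-- Appends the incidence list that starts at the cell in register `9` to the output. -/
def emitChain : RAMProg := loop 9 (load 10 4 9 ⨟ emit 10 ⨟ load 9 3 9)

theorem emitChain_runs {w o l : List ℕ} {n m pos : ℕ} {f : ℕ → List ℕ} {σ : RAMState}
    (hσ : BuildState w n m pos f o σ) (hl : Chain (σ.arr 3) (σ.arr 4) pos (σ.reg 9) l) :
    emitChain.Runs σ (5 * l.length + 1) fun τ => BuildState w n m pos f (o ++ l) τ ∧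
      τ.reg 6 = σ.reg 6 ∧ τ.reg 7 = σ.reg 7 ∧ τ.reg 12 = σ.reg 12 := by
  induction l generalizing σ o with
  | nil => exact .loop_done hl (by simpa using hσ)
  | cons x l ih =>
    obtain ⟨h0, -, hx, hl⟩ := hl
    refine (Runs.loop_step (k := 4) (l := 5 * l.length + 1) (Q := fun τ =>
      BuildState w n m pos f (o ++ [x]) τ ∧ Chain (τ.arr 3) (τ.arr 4) pos (τ.reg 9) l ∧
      τ.reg 6 = σ.reg 6 ∧ τ.reg 7 = σ.reg 7 ∧ τ.reg 12 = σ.reg 12) h0 ?_ ?_).mono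
      (by simp; omega) fun _ h => h
    · obtain ⟨h1, h2, h3, h4, h5, h6, h7, h8, h9⟩ := hσ
      refine IsStraight.runs (by simp [IsStraight, emit])
        ⟨⟨?_, ?_, ?_, ?_, ?_, ?_, ?_, ?_, ?_⟩, ?_, ?_, ?_, ?_⟩ <;>
        simp [emit, straightRun, RAMState.setReg, RAMState.setArr, update_overlay_of_eq, *]
    · rintro τ ⟨hτ, hl', h6, h7, h12⟩
      refine (ih hτ hl').mono le_rfl ?_
      rintro υ ⟨hυ, h6', h7', h12'⟩
      exact ⟨by simpa using hυ, h6'.trans h6, h7'.trans h7, h12'.trans h12⟩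

/-- Appends the code of the hyperarc of the vertex in register `6` to the output. -/
def emitArc (b : Bool) : RAMProg :=
  (emit 2 ⨟ emit 4 ⨟ load 10 5 6 ⨟ onlyIf b (add 10 10 2) ⨟ emit 10 ⨟ onlyIf b (emit 12) ⨟
    load 9 2 6) ⨟ emitChain ⨟ (add 6 6 2 ⨟ add 12 12 2 ⨟ sub 7 7 2)

/-- A block starts with its length, so the size of the head is needed before the linked list is
traversed; the array `5` of degrees supplies it. Register `12` runs through the private vertices `m
+ 2 + v`. -/
theorem emitArc_runs (b : Bool) {w o : List ℕ} {n m pos v : ℕ} {f : ℕ → List ℕ} {σ : RAMState}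
    (hσ : BuildState w n m pos f o σ) (hv : σ.reg 6 = v) (hv' : σ.reg 12 = m + 2 + v) :
    (emitArc b).Runs σ (5 * (f v).length + 15) fun τ =>
      BuildState w n m pos f (o ++ arcCode b m f v) τ ∧
      τ.reg 6 = v + 1 ∧ τ.reg 7 = σ.reg 7 - 1 ∧ τ.reg 12 = m + 2 + (v + 1) := by
  -- The `11` is the cost for `b = true`; without the additional vertex one step fewer is used.
  refine (Runs.seq (k := 11) (l := 5 * (f v).length + 4) (Q := fun τ =>
    BuildState w n m pos f (o ++ block [m] ++
      (if b then [(f v).length + 1, m + 2 + v] else [(f v).length])) τ ∧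
    Chain (τ.arr 3) (τ.arr 4) pos (τ.reg 9) (f v) ∧
    τ.reg 6 = v ∧ τ.reg 7 = σ.reg 7 ∧ τ.reg 12 = m + 2 + v) ?_ ?_).mono (by omega) fun _ h => h
  · obtain ⟨h1, h2, h3, h4, h5, h6, h7, h8, h9⟩ := hσ
    refine (IsStraight.runs (by cases b <;> simp [IsStraight, emit, onlyIf])
      ⟨⟨?_, ?_, ?_, ?_, ?_, ?_, ?_, ?_, ?_⟩, ?_, ?_, ?_, ?_⟩).mono
        (by cases b <;> simp [emit, onlyIf, straightCost]) fun _ h => h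
    all_goals
      cases b <;> simp [emit, onlyIf, straightRun, RAMState.setReg, RAMState.setArr,
        update_overlay_of_eq, block, *]
  · rintro τ ⟨hτ, hl, h6, h7, h12⟩
    refine (Runs.seq (l := 3) (emitChain_runs hτ hl) ?_).mono (by omega) fun _ h => h
    rintro υ ⟨⟨h1, h2, h3, h4, h5, h6, h7, h8, h9⟩, h10, h11, h12⟩
    refine IsStraight.runs (by simp [IsStraight])
     
      ⟨⟨?_, ?_, ?_, ?_, ?_, ?_, ?_, ?_, ?_⟩, ?_, ?_, ?_⟩ <;>
      cases b <;> simp_all [straightRun, RAMState.setReg, arcCode, headList, block, add_assoc]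

/-- Appends the codes of the hyperarcs of the vertices to the output. -/
def emitArcs (b : Bool) : RAMProg := loop 7 (emitArc b)

theorem emitArcs_runs (b : Bool) {w o : List ℕ} {n m pos v r : ℕ} {f : ℕ → List ℕ} {σ : RAMState}
    (hσ : BuildState w n m pos f o σ) (hv : σ.reg 6 = v) (hv' : σ.reg 12 = m + 2 + v)
    (hr : σ.reg 7 = r) :
    (emitArcs b).Runs σ (5 * ((List.range' v r).map fun u => (f u).length).sum + 16 * r + 1)
      (BuildState w n m pos f (o ++ ((List.range' v r).map (arcCode b m f)).flatten)) := by
  induction r generalizing σ o v with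
  | zero => exact .loop_done hr (by simpa using hσ)
  | succ r ih =>
    refine (Runs.loop_step (l := 5 * ((List.range' (v + 1) r).map fun u => (f u).length).sum +
      16 * r + 1) (by simp [hr]) (emitArc_runs b hσ hv hv') ?_).mono
      (by simp [List.range'_succ]; omega) fun _ h => h
    rintro τ ⟨hτ, h6, h7, h12⟩
    refine (ih hτ h6 h12 (by simp [h7, hr])).mono le_rfl fun υ hυ => ?_
    simpa [List.range'_succ] using hυ

/-- Appends the numbers from the one in register `6` on to the output, as many as register `7`
says. -/
def emitRange : RAMProg := loop 7 (emit 6 ⨟ add 6 6 2 ⨟ sub 7 7 2)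

theorem emitRange_runs {w o : List ℕ} {n m pos v r : ℕ} {f : ℕ → List ℕ} {σ : RAMState}
    (hσ : BuildState w n m pos f o σ) (hv : σ.reg 6 = v) (hr : σ.reg 7 = r) :
    emitRange.Runs σ (5 * r + 1) (BuildState w n m pos f (o ++ List.range' v r)) := by
  induction r generalizing σ o v with
  | zero => exact .loop_done hr (by simpa using hσ)
  | succ r ih =>
    refine (Runs.loop_step (k := 4) (l := 5 * r + 1) (Q := fun τ =>
      BuildState w n m pos f (o ++ [v]) τ ∧ τ.reg 6 = v + 1 ∧ τ.reg 7 = r) (by simp [hr]) ?_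
      ?_).mono (by omega) fun _ h => h
    · obtain ⟨h1, h2, h3, h4, h5, h6, h7, h8, h9⟩ := hσ
      refine IsStraight.runs (by simp [IsStraight, emit])
        ⟨⟨?_, ?_, ?_, ?_, ?_, ?_, ?_, ?_, ?_⟩, ?_, ?_⟩ <;>
        simp [emit, straightRun, RAMState.setReg, RAMState.setArr, update_overlay_of_eq, *]
    · rintro τ ⟨hτ, h6, h7⟩
      refine (ih hτ h6 h7).mono le_rfl fun υ hυ => ?_
      simpa [List.range'_succ] using hυ

/-- Appends the numbers of vertices and hyperarcs, the source and the sink to the output. -/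
def emitHeader (b : Bool) : RAMProg :=
  add 11 2 2 ⨟ add 12 4 11 ⨟ add 10 4 11 ⨟ onlyIf b (add 10 10 3) ⨟ emit 10 ⨟ add 10 3 2 ⨟
  emit 10 ⨟ emit 4 ⨟ add 10 4 2 ⨟ emit 10 ⨟ const 6 0 ⨟ add 7 3 6

theorem emitHeader_runs (b : Bool) {w : List ℕ} {n m pos : ℕ} {f : ℕ → List ℕ} {σ : RAMState}
    (hσ : BuildState w n m pos f [] σ) :
    (emitHeader b).Runs σ 16 fun τ =>
      BuildState w n m pos f [m + 2 + if b then n else 0, n + 1, m, m + 1] τ ∧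
      τ.reg 6 = 0 ∧ τ.reg 12 = m + 2 + 0 ∧ τ.reg 7 = n := by
  obtain ⟨h1, h2, h3, h4, h5, h6, h7, h8, h9⟩ := hσ
  rw [List.length_nil] at h3
  refine (IsStraight.runs (by cases b <;> simp [IsStraight, emitHeader, emit, onlyIf])
    ⟨⟨?_, ?_, ?_, ?_, ?_, ?_, ?_, ?_, ?_⟩, ?_, ?_, ?_⟩).mono
      (by cases b <;> simp [emitHeader, emit, onlyIf, straightCost]) fun _ h => h
  all_goals
    cases b <;> simp [emitHeader, emit, onlyIf, straightRun, RAMState.setReg, RAMState.setArr,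
      update_overlay_of_eq, *]

/-- Appends the number of hyperedges to the output and prepares the list of all hyperedges. -/
def emitCount : RAMProg := emit 4 ⨟ const 6 0 ⨟ add 7 4 6

theorem emitCount_runs {w o : List ℕ} {n m pos : ℕ} {f : ℕ → List ℕ} {σ : RAMState}
    (hσ : BuildState w n m pos f o σ) :
    emitCount.Runs σ 4 fun τ => BuildState w n m pos f (o ++ [m]) τ ∧
      τ.reg 6 = 0 ∧ τ.reg 7 = m := by
  obtain ⟨h1, h2, h3, h4, h5, h6, h7, h8, h9⟩ := hσ
  refine IsStraight.runs (by simp [IsStraight, emitCount, emit])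
    ⟨⟨?_, ?_, ?_, ?_, ?_, ?_, ?_, ?_, ?_⟩, ?_, ?_⟩ <;>
    simp [emitCount, emit, straightRun, RAMState.setReg, RAMState.setArr, update_overlay_of_eq, *]

/-- Appends the head of the last hyperarc to the output. -/
def emitSink : RAMProg := emit 2 ⨟ add 10 4 2 ⨟ emit 10

theorem emitSink_runs {w o : List ℕ} {n m pos : ℕ} {f : ℕ → List ℕ} {σ : RAMState}
    (hσ : BuildState w n m pos f o σ) :
    emitSink.Runs σ 5 (BuildState w n m pos f (o ++ block [m + 1])) := by
  obtain ⟨h1, h2, h3, h4, h5, h6, h7, h8, h9⟩ := hσ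
  refine IsStraight.runs (by simp [IsStraight, emitSink, emit])
    ⟨?_, ?_, ?_, ?_, ?_, ?_, ?_, ?_, ?_⟩ <;>
    simp [emitSink, emit, straightRun, RAMState.setReg, RAMState.setArr, update_overlay_of_eq,
      block, *]

/-- Computes the code of the directed hypergraph of the input. -/
def buildDir (b : Bool) : RAMProg :=
  readHypergraph ⨟ emitHeader b ⨟ emitArcs b ⨟ emitCount ⨟ emitRange ⨟ emitSink

theorem buildDir_runs (b : Bool) {w : List ℕ} {n : ℕ} {L : List (List ℕ)} {f : ℕ → List ℕ}
    (hw : w = n :: L.length :: (L.map block).flatten)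
    (hf : f = insertEdges 0 L fun _ => []) :
    (buildDir b).Runs (RAMState.init w)
      (11 * (L.map List.length).sum + 5 * ((List.range n).map fun v => (f v).length).sum +
        16 * n + 11 * L.length + 34)
      (BuildState w n L.length w.length f (dirCode b n L.length f)) := by
  subst hf
  refine (Runs.seq (readHypergraph_runs hw) fun τ hτ =>
    Runs.seq (emitHeader_runs b hτ) fun τ hτ =>
    Runs.seq (emitArcs_runs b hτ.1 hτ.2.1 hτ.2.2.1 hτ.2.2.2) fun τ hτ =>
    Runs.seq (emitCount_runs hτ) fun τ hτ =>
    Runs.seq (emitRange_runs hτ.1 hτ.2.1 hτ.2.2) fun τ hτ => emitSink_runs hτ).mono ?_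
    fun τ hτ => ?_
  · simp only [List.range_eq_range']
    omega
  · simpa [dirCode, block, List.range_eq_range'] using hτ

end Construction

/-! ### The total length of the incidence lists -/

section Construction

/-- Double counting: a hyperedge lengthens the lists of exactly those vertices below `n` that it
contains. -/
theorem sum_length_insertEdges_le (n : ℕ) {e : ℕ} {L : List (List ℕ)} (hL : ∀ l ∈ L, l.Nodup)
    (f : ℕ → List ℕ) :
    ∑ v ∈ Finset.range n, (insertEdges e L f v).length ≤
      ∑ v ∈ Finset.range n, (f v).length + (L.map List.length).sum := by
  induction L generalizing e f with
  | nil => simp [insertEdges]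
  | cons l L ih =>
    rw [List.forall_mem_cons] at hL
    refine (ih hL.2 _).trans ?_
    have h₁ : ∑ v ∈ Finset.range n, (insertEdge e l f v).length =
        ∑ v ∈ Finset.range n, (f v).length + ((Finset.range n).filter (· ∈ l)).card := by
      rw [Finset.card_filter, ← Finset.sum_add_distrib]
      refine Finset.sum_congr rfl fun v _ => ?_
      rw [insertEdge_apply hL.1]
      split_ifs <;> simp
    have h₂ : ((Finset.range n).filter (· ∈ l)).card ≤ l.length :=
      (Finset.card_le_card fun v hv => by simpa using (Finset.mem_filter.1 hv).2).trans
        l.toFinset_card_le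
    simp only [List.map_cons, List.sum_cons]
    omega

end Construction

/-! ### Turning hyperpaths into transversals -/

section Translation

local infixr:60 " ⨟ " => RAMProg.seq

open RAMProg

/-- The situation while the hyperpaths `o` (in the array `10`) are translated to transversals.
Register `1` holds the length of the output, register `2` holds `1`, register `3` the number of
vertices of the hypergraph, and register `5` the reading position. -/
structure TranslateState (o : List ℕ) (y z : ℕ → ℕ) (n pos : ℕ) (out : List ℕ) (σ : RAMState) :
    Prop where
  input : σ.arr 10 = overlay o y
  written : σ.arr 1 = overlay out z
  outLength : σ.reg 1 = out.length
  one : σ.reg 2 = 1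
  vertices : σ.reg 3 = n
  position : σ.reg 5 = pos

/-- Copies an entry to the output, unless it is too large. -/
def translateEntry : RAMProg :=
  (load 9 10 5 ⨟ sub 10 3 9) ⨟ ite 10 (emit 9) skip ⨟ (add 5 5 2 ⨟ sub 8 8 2)

theorem translateEntry_runs {o out pre rest : List ℕ} {y z : ℕ → ℕ} {n x : ℕ} {σ : RAMState}
    (ho : o = pre ++ x :: rest) (hσ : TranslateState o y z n pre.length out σ) :
    translateEntry.Runs σ 7 fun τ =>
      TranslateState o y z n (pre.length + 1) (out ++ [x].filter (· < n)) τ ∧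
      τ.reg 7 = σ.reg 7 ∧ τ.reg 8 = σ.reg 8 - 1 := by
  have hx : overlay o y pre.length = x := by rw [ho, overlay_append_cons]
  clear ho
  refine Runs.seq (k := 2) (l := 5) (Q := fun τ => TranslateState o y z n pre.length out τ ∧
    τ.reg 7 = σ.reg 7 ∧ τ.reg 8 = σ.reg 8 ∧ τ.reg 9 = x ∧ τ.reg 10 = n - x) ?_ ?_
  · obtain ⟨h1, h2, h3, h4, h5, h6⟩ := hσ
    refine IsStraight.runs (by simp [IsStraight]) ⟨⟨?_, ?_, ?_, ?_, ?_, ?_⟩, ?_, ?_, ?_, ?_⟩ <;>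
      simp [straightRun, RAMState.setReg, *]
  · rintro τ ⟨hτ, h7, h8, h9, h10⟩
    refine Runs.seq (k := 3) (l := 2) (Q := fun τ =>
      TranslateState o y z n pre.length (out ++ [x].filter (· < n)) τ ∧
      τ.reg 7 = σ.reg 7 ∧ τ.reg 8 = σ.reg 8) ?_ ?_
    -- The truncated difference `n - x` in register `10` is nonzero exactly when `x < n`.
    · by_cases hxn : x < n
      · refine Runs.ite_true (by omega) ?_
        obtain ⟨h1, h2, h3, h4, h5, h6⟩ := hτ
        refine IsStraight.runs (by simp [emit, IsStraight])
          ⟨⟨?_, ?_, ?_, ?_, ?_, ?_⟩, ?_, ?_⟩ <;>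
          simp [emit, straightRun, RAMState.setReg, RAMState.setArr, update_overlay_of_eq, *]
      · refine (Runs.ite_false (k := 1) (by omega) ?_).mono (by simp) fun _ h => h
        exact IsStraight.runs (p := skip) (by simp [IsStraight])
          ⟨by simpa [hxn, straightRun] using hτ, h7, h8⟩
    · rintro υ ⟨⟨h1, h2, h3, h4, h5, h6⟩, h7, h8⟩
      refine IsStraight.runs (by simp [IsStraight]) ⟨⟨?_, ?_, ?_, ?_, ?_, ?_⟩, ?_, ?_⟩ <;>
        simp [straightRun, RAMState.setReg, *]

theorem loop_translateEntry_runs {o out pre l rest : List ℕ} {y z : ℕ → ℕ} {n : ℕ} {σ : RAMState}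
    (ho : o = pre ++ (l ++ rest)) (hσ : TranslateState o y z n pre.length out σ)
    (hl : σ.reg 8 = l.length) :
    (loop 8 translateEntry).Runs σ (8 * l.length + 1) fun τ =>
      TranslateState o y z n (pre.length + l.length) (out ++ l.filter (· < n)) τ ∧
      τ.reg 7 = σ.reg 7 := by
  induction l generalizing σ pre out with
  | nil => exact .loop_done hl ⟨by simpa using hσ, rfl⟩
  | cons x l ih =>
    refine (Runs.loop_step (k := 7) (l := 8 * l.length + 1) (by simp [hl])
      (translateEntry_runs ho hσ) ?_).mono (by simp; omega) fun _ h => h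
    rintro τ ⟨hτ, h7, h8⟩
    refine (ih (pre := pre ++ [x]) (by simp [ho]) (by simpa using hτ)
      (by simp [h8, hl])).mono le_rfl ?_
    rintro υ ⟨hυ, h7'⟩
    refine ⟨?_, h7'.trans h7⟩
    rw [← List.singleton_append, List.filter_append]
    simpa only [List.length_append, List.append_assoc, add_assoc] using hυ

/-- Copies a block to the output, without the entry that is too large. -/
def translateBlock : RAMProg :=
  (load 8 10 5 ⨟ sub 10 8 2 ⨟ emit 10 ⨟ sub 7 7 2 ⨟ sub 7 7 8 ⨟ add 5 5 2) ⨟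
  loop 8 translateEntry

/-- The new length is written before the entries are seen. By `hl` it is the old length minus one:
the only entry lost is the number of the last hyperarc. -/
theorem translateBlock_runs {o out pre l rest : List ℕ} {y z : ℕ → ℕ} {n : ℕ} {σ : RAMState}
    (ho : o = pre ++ (block l ++ rest)) (hσ : TranslateState o y z n pre.length out σ)
    (hl : (l.filter (· < n)).length = l.length - 1) :
    translateBlock.Runs σ (8 * l.length + 8) fun τ =>
      TranslateState o y z n (pre.length + (block l).length)
        (out ++ block (l.filter (· < n))) τ ∧
      τ.reg 7 = σ.reg 7 - (block l).length := by
  have hx : overlay o y pre.length = l.length := by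
    rw [ho, block, List.cons_append, overlay_append_cons]
  refine (Runs.seq (k := 7) (l := 8 * l.length + 1) (Q := fun τ =>
    TranslateState o y z n (pre.length + 1) (out ++ [l.length - 1]) τ ∧
    τ.reg 7 = σ.reg 7 - (block l).length ∧ τ.reg 8 = l.length) ?_ ?_).mono (by omega) fun _ h => h
  · clear ho
    obtain ⟨h1, h2, h3, h4, h5, h6⟩ := hσ
    refine IsStraight.runs (by simp [emit, IsStraight])
      ⟨⟨?_, ?_, ?_, ?_, ?_, ?_⟩, ?_, ?_⟩ <;>
      simp [emit, straightRun, RAMState.setReg, RAMState.setArr, update_overlay_of_eq, block, *]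
    omega
  · rintro τ ⟨hτ, h7, h8⟩
    refine (loop_translateEntry_runs (o := o) (pre := pre ++ [l.length]) (l := l) (rest := rest)
      (by simp [ho, block]) (by simpa using hτ) h8).mono le_rfl ?_
    rintro υ ⟨hυ, h7'⟩
    refine ⟨?_, h7'.trans h7⟩
    simpa [block, hl, add_assoc, add_comm 1] using hυ

/-- Register `7` counts the cells left, not the blocks, since the enumerator reports only the total
length of its output. A pass costs `8 * l.length + 9`, at most `9` per cell. -/
theorem loop_translateBlock_runs {o out pre : List ℕ} {y z : ℕ → ℕ} {n : ℕ} {σ : RAMState}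
    {L : List (List ℕ)} (ho : o = pre ++ (L.map block).flatten)
    (hσ : TranslateState o y z n pre.length out σ)
    (hL : ∀ l ∈ L, (l.filter (· < n)).length = l.length - 1)
    (hr : σ.reg 7 = ((L.map block).flatten).length) :
    (loop 7 translateBlock).Runs σ (9 * (L.map fun l => l.length + 1).sum + 1)
      (TranslateState o y z n o.length
        (out ++ ((L.map (List.filter (· < n))).map block).flatten)) := by
  induction L generalizing σ pre out with
  | nil => exact .loop_done hr (by simpa [ho] using hσ)
  | cons l L ih =>
    rw [List.forall_mem_cons] at hL
    rw [List.map_cons, List.flatten_cons] at ho hr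
    refine (Runs.loop_step (l := 9 * (L.map fun l => l.length + 1).sum + 1)
      (by simp [hr, block]) (translateBlock_runs ho hσ hL.1) ?_).mono (by simp; omega) fun _ h => h
    rintro τ ⟨hτ, h7⟩
    refine (ih (pre := pre ++ block l) (by simp [ho]) (by simpa using hτ) hL.2
      (by simp [h7, hr])).mono le_rfl fun υ hυ => ?_
    simpa using hυ

/-- Translates the hyperpaths in the array `10`, whose codes have the total length in
register `20`, to transversals. -/
def translate : RAMProg :=
  (const 2 1 ⨟ const 5 0 ⨟ const 1 0 ⨟ const 6 0 ⨟ load 3 0 6 ⨟ add 7 20 6) ⨟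
  loop 7 translateBlock

theorem translate_runs {n : ℕ} {σ : RAMState} {y : ℕ → ℕ} {L : List (List ℕ)}
    (hn : σ.arr 0 0 = n) (ho : σ.arr 10 = overlay (L.map block).flatten y)
    (hr : σ.reg 20 = ((L.map block).flatten).length)
    (hL : ∀ l ∈ L, (l.filter (· < n)).length = l.length - 1) :
    translate.Runs σ (9 * (L.map fun l => l.length + 1).sum + 7) fun τ =>
      τ.output = ((L.map (List.filter (· < n))).map block).flatten := by
  -- Array `1` may hold old data; with the output length reset to `0` this is the overlay of the
  -- empty list.
  refine (Runs.seq (k := 6) (l := 9 * (L.map fun l => l.length + 1).sum + 1) (Q := fun τ =>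
    TranslateState (L.map block).flatten y (σ.arr 1) n 0 [] τ ∧
    τ.reg 7 = ((L.map block).flatten).length) ?_ ?_).mono (by omega) fun _ h => h
  · refine IsStraight.runs (by simp [IsStraight]) ⟨⟨?_, ?_, ?_, ?_, ?_, ?_⟩, ?_⟩ <;>
      simp [straightRun, RAMState.setReg, *]
    rfl
  · rintro τ ⟨hτ, h7⟩
    refine (loop_translateBlock_runs (pre := []) rfl hτ hL h7).mono le_rfl fun υ hυ => ?_
    exact RAMState.output_eq hυ.outLength hυ.written

end Translation

/-! ### Codes, sizes and the padded directed hypergraph -/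

section Codes

theorem finsum_ncard_entries {L : List (List ℕ)} (hL : ∀ l ∈ L, l.Nodup)
    (hL' : (L.map entries).Nodup) :
    ∑ᶠ e ∈ {X | X ∈ L.map entries}, Set.ncard e = (L.map List.length).sum := by
  induction L with
  | nil => simp
  | cons l L ih =>
    rw [List.forall_mem_cons] at hL
    rw [List.map_cons, List.nodup_cons] at hL'
    have h : {X | X ∈ (l :: L).map entries} = insert (entries l) {X | X ∈ L.map entries} := by
      ext X; simp [eq_comm]
    have hcard : (entries l).ncard = l.length := by
      rw [← List.toFinset_card_of_nodup hL.1, ← Set.ncard_coe_finset]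
      congr 1
      ext x; simp [entries]
    rw [h, finsum_mem_insert _ (s := {X | X ∈ L.map entries}) hL'.1 (List.finite_toSet _),
      ih hL.2 hL'.2, hcard, List.map_cons, List.sum_cons]

theorem length_le_sum_length {L : List (List ℕ)} (hL : ∀ l ∈ L, l ≠ []) :
    L.length ≤ (L.map List.length).sum := by
  induction L with
  | nil => simp
  | cons l L ih =>
    rw [List.forall_mem_cons] at hL
    have := ih hL.2
    have := List.length_pos_iff.2 hL.1
    simp only [List.length_cons, List.map_cons, List.sum_cons]
    omega

/-- At most one list is empty, and every other one contributes at least `1`. This bounds the number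
of hyperedges by the size of the hypergraph plus one. -/
theorem length_le_sum_length_add_one {L : List (List ℕ)} (hL : L.Nodup) :
    L.length ≤ (L.map List.length).sum + 1 := by
  induction L with
  | nil => simp
  | cons l L ih =>
    rw [List.nodup_cons] at hL
    simp only [List.length_cons, List.map_cons, List.sum_cons]
    rcases eq_or_ne l [] with rfl | hl
    · have := length_le_sum_length (L := L) fun l hl h => hL.1 (h ▸ hl)
      omega
    · have := ih hL.2
      have := List.length_pos_iff.2 hl
      omega

theorem hypergraphSize_eq {n : ℕ} {H : Hypergraph ℕ} {L : List (List ℕ)}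
    (hn : H.vertexSet = Set.Iio n) (hL : ListsFamily L H.edgeSet) :
    hypergraphSize H = n + (L.map List.length).sum := by
  have : H.edgeSet = {X | X ∈ L.map entries} := Set.ext fun X => (hL.2.2 X).symm
  rw [hypergraphSize, this, finsum_ncard_entries hL.1 hL.2.1, hn]
  congr 1
  rw [← Finset.coe_Iio, Set.ncard_coe_finset, Nat.card_Iio]

theorem ListsFamily.exists_equiv {L : List (List ℕ)} {F : Set (Set ℕ)} (hL : ListsFamily L F) :
    ∃ ι : F ≃ Fin L.length, ∀ e x, x ∈ L[(ι e : ℕ)] ↔ x ∈ (e : Set ℕ) := by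
  have hmem : ∀ i : Fin L.length, entries L[i] ∈ F := fun i =>
    (hL.2.2 _).1 (List.mem_map_of_mem (List.getElem_mem _))
  let g : Fin L.length → F := fun i => ⟨entries L[i], hmem i⟩
  have hg : Function.Bijective g := by
    constructor
    · intro i j hij
      have h : entries L[i] = entries L[j] := congrArg Subtype.val hij
      have := (hL.2.1.getElem_inj_iff (i := i) (j := j) (hi := by simp) (hj := by simp)).1
        (by simpa using h)
      exact Fin.ext this
    · rintro ⟨e, he⟩
      obtain ⟨l, hl, rfl⟩ := List.mem_map.1 ((hL.2.2 e).2 he)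
      obtain ⟨i, hi, rfl⟩ := List.mem_iff_getElem.1 hl
      exact ⟨⟨i, hi⟩, rfl⟩
  refine ⟨(Equiv.ofBijective g hg).symm, fun e x => ?_⟩
  obtain ⟨i, rfl⟩ := hg.2 e
  have hi : (Equiv.ofBijective g hg).symm (g i) = i :=
    (Equiv.ofBijective g hg).symm_apply_apply i
  simp only [hi]
  rfl

theorem ListsFamily.ncard_eq {L : List (List ℕ)} {F : Set (Set ℕ)} (hL : ListsFamily L F) :
    F.ncard = L.length := by
  obtain ⟨ι, -⟩ := hL.exists_equiv
  simpa using Nat.card_congr ι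

/-- The list of the tail of the hyperarc `a`. -/
def arcTail (n m a : ℕ) : List ℕ := if a < n then [m] else List.range m

/-- The list of the head of the hyperarc `a`. -/
def arcHead (b : Bool) (n m : ℕ) (f : ℕ → List ℕ) (a : ℕ) : List ℕ :=
  if a < n then headList b m f a else [m + 1]

theorem dirCode_eq (b : Bool) (n m : ℕ) (f : ℕ → List ℕ) :
    dirCode b n m f = (m + 2 + if b then n else 0) :: (n + 1) :: m :: (m + 1) ::
      (List.ofFn fun j : Fin (n + 1) =>
        block (arcTail n m j) ++ block (arcHead b n m f j)).flatten := by
  have h : (List.ofFn fun j : Fin (n + 1) =>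
      block (arcTail n m j) ++ block (arcHead b n m f j)) =
      (List.range n).map (arcCode b m f) ++ [block (List.range m) ++ block [m + 1]] := by
    refine List.ext_getElem (by simp) fun i h₁ h₂ => ?_
    rw [List.length_ofFn] at h₁
    rw [List.getElem_ofFn, List.getElem_append]
    simp only [List.length_map, List.length_range, List.getElem_map, List.getElem_range]
    split_ifs with hi
    · simp [arcTail, arcHead, hi, arcCode]
    · have : i = n := by omega
      subst this
      simp [arcTail, arcHead]
  rw [h]
  simp [dirCode]

/-- The lists `f v` describe which of the hyperedges, numbered by `ι`, contain `v`. -/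
structure IncidenceLists (H : Hypergraph ℕ) (n m : ℕ) (ι : H.edgeSet ≃ Fin m)
    (f : ℕ → List ℕ) : Prop where
  nodup : ∀ v, (f v).Nodup
  lt : ∀ v, ∀ x ∈ f v, x < m
  mem_iff : ∀ v (e : H.edgeSet), (ι e : ℕ) ∈ f v ↔ v ∈ (e : Set ℕ)
  vertexSet_eq : H.vertexSet = Set.Iio n

theorem exists_incidenceLists {n : ℕ} {H : Hypergraph ℕ} {L : List (List ℕ)}
    (hn : H.vertexSet = Set.Iio n) (hL : ListsFamily L H.edgeSet) :
    ∃ ι, IncidenceLists H n L.length ι (insertEdges 0 L fun _ => []) := by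
  obtain ⟨ι, hι⟩ := hL.exists_equiv
  refine ⟨ι, fun v => nodup_insertEdges hL.1 _ (by simp) v, fun v x hx => ?_, fun v e => ?_, hn⟩
  · rw [mem_insertEdges hL.1] at hx
    simp only [List.not_mem_nil, false_or] at hx
    obtain ⟨i, hi, -, rfl⟩ := hx
    simpa using hi
  · rw [mem_insertEdges hL.1, ← hι]
    simp only [List.not_mem_nil, false_or, zero_add]
    constructor
    · rintro ⟨i, hi, hv, hi'⟩
      simpa [hi'] using hv
    · exact fun h => ⟨ι e, (ι e).2, h, rfl⟩

theorem IncidenceLists.nodup_headList {H : Hypergraph ℕ} {n m : ℕ} {ι : H.edgeSet ≃ Fin m}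
    {f : ℕ → List ℕ} (hf : IncidenceLists H n m ι f) (b : Bool) (v : ℕ) :
    (headList b m f v).Nodup := by
  cases b
  · simpa [headList] using hf.nodup v
  · simp only [headList, if_true, List.nodup_cons]
    exact ⟨fun h => by have := hf.lt v _ h; omega, hf.nodup v⟩

theorem nodup_arcTail (n m a : ℕ) : (arcTail n m a).Nodup := by
  unfold arcTail
  split_ifs
  · simp
  · exact List.nodup_range

theorem IncidenceLists.nodup_arcHead {H : Hypergraph ℕ} {n m : ℕ} {ι : H.edgeSet ≃ Fin m}
    {f : ℕ → List ℕ} (hf : IncidenceLists H n m ι f) (b : Bool) (a : ℕ) :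
    (arcHead b n m f a).Nodup := by
  unfold arcHead
  split_ifs
  · exact hf.nodup_headList b a
  · simp

theorem IncidenceLists.exists_isCode_toDir {H : Hypergraph ℕ} {n m : ℕ} {ι : H.edgeSet ≃ Fin m}
    {f : ℕ → List ℕ} (hf : IncidenceLists H n m ι f) :
    ∃ (eV : Node H.edgeSet ≃ Fin (m + 2)) (eA : Option H.vertexSet ≃ Fin (n + 1)),
      (∀ v : H.vertexSet, (eA (some v) : ℕ) = v) ∧
      (toDir H).IsCode eV eA Node.source Node.sink (dirCode false n m f) := by
  have hlt : ∀ v : H.vertexSet, (v : ℕ) < n := fun v => by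
    simpa using hf.vertexSet_eq.subset v.2
  -- The numbering behind `dirCode`: hyperedges by `ι`, then the source `m` and the sink `m + 1`.
  let gV : Node H.edgeSet → Fin (m + 2)
    | .edge e => ⟨ι e, by have := (ι e).2; omega⟩
    | .source => ⟨m, by omega⟩
    | .sink => ⟨m + 1, by omega⟩
  have hgV : Function.Bijective gV := by
    constructor
    · rintro (e | _ | _) (e' | _ | _) h <;> simp only [gV, Fin.mk.injEq] at h
      · rw [ι.injective (Fin.ext h)]
      · have := (ι e).2; omega
      · have := (ι e).2; omega
      · have := (ι e').2; omega
      · rfl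
      · omega
      · have := (ι e').2; omega
      · omega
      · rfl
    · rintro ⟨i, hi⟩
      rcases lt_or_ge i m with h | h
      · exact ⟨.edge (ι.symm ⟨i, h⟩), by simp [gV]⟩
      · obtain rfl | rfl : i = m ∨ i = m + 1 := by omega
        · exact ⟨.source, rfl⟩
        · exact ⟨.sink, rfl⟩
  let gA : Option H.vertexSet → Fin (n + 1)
    | some v => ⟨v, (hlt v).trans n.lt_succ_self⟩
    | none => ⟨n, n.lt_succ_self⟩
  have hgA : Function.Bijective gA := by
    constructor
    · rintro (_ | u) (_ | v) h <;> simp only [gA, Fin.mk.injEq] at h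
      · rfl
      · have := hlt v; omega
      · have := hlt u; omega
      · rw [Subtype.ext h]
    · rintro ⟨i, hi⟩
      rcases lt_or_ge i n with h | h
      · exact ⟨some ⟨i, by rw [hf.vertexSet_eq]; exact h⟩, rfl⟩
      · obtain rfl : i = n := by omega
        exact ⟨none, rfl⟩
  refine ⟨.ofBijective gV hgV, .ofBijective gA hgA, fun v => rfl, fun j => arcTail n m j,
    fun j => arcHead false n m f j, ?_, ?_, ?_⟩
  · rintro (_ | v) <;> refine ⟨nodup_arcTail _ _ _, fun x => ?_⟩
    · simp only [Equiv.ofBijective_apply, gA, arcTail, lt_irrefl, if_false, List.mem_range, toDir,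
        Set.exists_range_iff, gV]
      exact ⟨fun h => ⟨ι.symm ⟨x, h⟩, by simp⟩, by rintro ⟨e, rfl⟩; exact (ι e).2⟩
    · simp [gA, arcTail, hlt v, toDir, gV, eq_comm]
  · rintro (_ | v) <;> refine ⟨hf.nodup_arcHead _ _, fun x => ?_⟩
    · simp [gA, arcHead, toDir, gV, eq_comm]
    · simp only [Equiv.ofBijective_apply, gA, arcHead, hlt v, if_true, headList, toDir,
        Set.exists_mem_image, gV]
      constructor
      · intro h
        have hx := hf.lt v x h
        refine ⟨ι.symm ⟨x, hx⟩, ?_, by simp⟩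
        exact (hf.mem_iff v _).1 (by simpa using h)
      · rintro ⟨e, he, rfl⟩
        exact (hf.mem_iff v e).2 he
  · simpa [gV] using dirCode_eq false n m f

/-- The directed hypergraph of a hypergraph on `0, …, n - 1` with `m` hyperedges and the incidence
lists `f`, where the head of the hyperarc of the vertex `v` contains a further vertex
`m + 2 + v`. -/
def paddedDir (n m : ℕ) (f : ℕ → List ℕ) (hf : ∀ v, ∀ x ∈ f v, x < m) :
    DirHypergraph (Fin (m + 2 + n)) (Fin (n + 1)) where
  tail a := {x | (x : ℕ) ∈ arcTail n m a}
  head a := {x | (x : ℕ) ∈ arcHead true n m f a}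
  disjoint a := by
    rw [Set.disjoint_left]
    intro x hx hx'
    simp only [Set.mem_ofPred_eq, arcTail, arcHead] at hx hx'
    split_ifs at hx hx'
    · simp only [headList, if_true, List.mem_cons, List.not_mem_nil, or_false] at hx hx'
      rcases hx' with h | h
      · omega
      · have := hf _ _ h
        omega
    · simp only [List.mem_range, List.mem_cons, List.not_mem_nil, or_false] at hx hx'
      omega

/-- The private vertex identifies the hyperarc even when two vertices lie in the same hyperedges. -/
theorem paddedDir_isSimple {n m : ℕ} {f : ℕ → List ℕ} (hf : ∀ v, ∀ x ∈ f v, x < m) :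
    (paddedDir n m f hf).IsSimple := by
  have key : ∀ a b : Fin (n + 1), (a : ℕ) < n →
      ((paddedDir n m f hf).tail a, (paddedDir n m f hf).head a) =
        ((paddedDir n m f hf).tail b, (paddedDir n m f hf).head b) → a = b := by
    intro a b ha hab
    -- The source `m` in the tail excludes the last hyperarc, whose tail is `0, …, m - 1`; then `m +
    -- 2 + a` in the head forces `b = a`.
    have htail := congrArg (fun p => (⟨m, by omega⟩ : Fin (m + 2 + n)) ∈ p.1) hab
    have hhead := congrArg (fun p => (⟨m + 2 + a, by omega⟩ : Fin (m + 2 + n)) ∈ p.2) hab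
    simp only [paddedDir, Set.mem_ofPred_eq, arcTail, arcHead, ha, if_true, headList,
      List.mem_cons, true_or, eq_iff_iff, true_iff] at htail hhead
    split_ifs at htail hhead with hb
    · rcases List.mem_cons.1 hhead with h | h
      · exact Fin.ext (by omega)
      · have := hf _ _ h
        omega
    · simp at htail
  intro a b hab
  rcases lt_or_ge (a : ℕ) n with ha | ha
  · exact key a b ha hab
  · rcases lt_or_ge (b : ℕ) n with hb | hb
    · exact (key b a hb hab.symm).symm
    · exact Fin.ext (by omega)

theorem paddedDir_isBF {n m : ℕ} {f : ℕ → List ℕ} (hf : ∀ v, ∀ x ∈ f v, x < m) :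
    (paddedDir n m f hf).IsBF := by
  intro a
  by_cases ha : (a : ℕ) < n
  · right
    rw [Set.ncard_eq_one]
    refine ⟨⟨m, by omega⟩, ?_⟩
    ext x
    simp [paddedDir, arcTail, ha, Fin.ext_iff]
  · left
    rw [Set.ncard_eq_one]
    refine ⟨⟨m + 1, by omega⟩, ?_⟩
    ext x
    simp [paddedDir, arcHead, ha, Fin.ext_iff]

/-- Each of the `2 * (n + 1)` tails and heads is bounded by the number of all vertices; a polynomial
bound suffices. -/
theorem size_paddedDir_le {n m : ℕ} {f : ℕ → List ℕ} (hf : ∀ v, ∀ x ∈ f v, x < m) :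
    (paddedDir n m f hf).size ≤ (m + 2 + n) * (2 * n + 3) := by
  have hcard : ∀ S : Set (Fin (m + 2 + n)), S.ncard ≤ m + 2 + n := fun S => by
    simpa using Set.ncard_le_card S
  have : ∑ a, (((paddedDir n m f hf).tail a).ncard + ((paddedDir n m f hf).head a).ncard) ≤
      ∑ _a : Fin (n + 1), 2 * (m + 2 + n) :=
    Finset.sum_le_sum fun a _ => by
      have := hcard ((paddedDir n m f hf).tail a)
      have := hcard ((paddedDir n m f hf).head a)
      omega
  rw [Finset.sum_const, Finset.card_univ, Fintype.card_fin, smul_eq_mul] at this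
  rw [DirHypergraph.size, Fintype.card_fin]
  nlinarith

/-- The instance of hyperpath enumeration for the padded directed hypergraph. -/
def paddedInst (n m : ℕ) (f : ℕ → List ℕ) (hf : ∀ v, ∀ x ∈ f v, x < m) : HyperpathInst where
  n := m + 2 + n
  m := n + 1
  D := paddedDir n m f hf
  simple := paddedDir_isSimple hf
  bf := paddedDir_isBF hf
  s := ⟨m, by omega⟩
  t := ⟨m + 1, by omega⟩

theorem IncidenceLists.isCode_paddedInst {H : Hypergraph ℕ} {n m : ℕ} {ι : H.edgeSet ≃ Fin m}
    {f : ℕ → List ℕ} (hf : IncidenceLists H n m ι f) :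
    hyperpathEnumBF.IsCode (paddedInst n m f hf.lt) (dirCode true n m f) := by
  refine ⟨fun j => arcTail n m j, fun j => arcHead true n m f j, fun a => ⟨nodup_arcTail _ _ _,
    fun x => ?_⟩, fun a => ⟨hf.nodup_arcHead _ _, fun x => ?_⟩, dirCode_eq true n m f⟩
  · have hx : x ∈ arcTail n m a → x < m + 2 + n := by
      unfold arcTail
      split_ifs <;> simp <;> omega
    exact ⟨fun h => ⟨⟨x, hx h⟩, h, rfl⟩, by rintro ⟨v, hv, rfl⟩; exact hv⟩
  · have hx : x ∈ arcHead true n m f a → x < m + 2 + n := by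
      simp only [arcHead, headList, if_true]
      split_ifs
      · intro h
        rcases List.mem_cons.1 h with h | h
        · omega
        · have := hf.lt _ _ h
          omega
      · intro h
        have := List.mem_singleton.1 h
        omega
    exact ⟨fun h => ⟨⟨x, hx h⟩, h, rfl⟩, by rintro ⟨v, hv, rfl⟩; exact hv⟩

/-- The private vertices are neither nodes nor the sink, so padding keeps the structure of a
`TransversalNetwork`. Since `A_v` has the number `v` and the last hyperarc the number `n`, a
hyperpath is output as `insert n T`. -/
theorem IncidenceLists.solutions_paddedInst {H : Hypergraph ℕ} {n m : ℕ}
    {ι : H.edgeSet ≃ Fin m} {f : ℕ → List ℕ} (hf : IncidenceLists H n m ι f) :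
    hyperpathEnumBF.solutions (paddedInst n m f hf.lt) =
      insert n '' {T | IsMinimalTransversal H T} := by
  have hlt : ∀ v : H.vertexSet, (v : ℕ) < n := fun v => by
    simpa using hf.vertexSet_eq.subset v.2
  let node : H.edgeSet → Fin (m + 2 + n) := fun e => ⟨ι e, by have := (ι e).2; omega⟩
  let arc : H.vertexSet → Fin (n + 1) := fun v => ⟨v, (hlt v).trans n.lt_succ_self⟩
  have net : TransversalNetwork H (paddedDir n m f hf.lt) ⟨m, by omega⟩ ⟨m + 1, by omega⟩
      node arc (Fin.last n) :=
    { arc_injective := fun u v h => Subtype.ext (by simpa [arc] using h)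
      arc_ne_last := fun v h => by
        have := hlt v
        have := congrArg Fin.val h
        simp only [arc, Fin.val_last] at this
        omega
      eq_arc_or_eq_last := fun a => by
        rcases lt_or_ge (a : ℕ) n with ha | ha
        · exact .inl ⟨⟨a, by rw [hf.vertexSet_eq]; exact ha⟩, rfl⟩
        · exact .inr (Fin.ext (by simp; omega))
      tail_arc := fun v => by
        ext x
        simp [paddedDir, arcTail, arc, hlt v, Fin.ext_iff]
      node_mem_head_arc := fun v e => by
        have : (ι e : ℕ) ≠ m + 2 + v := by have := (ι e).2; omega
        simp [paddedDir, arcHead, headList, arc, node, hlt v, this, hf.mem_iff]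
      target_notMem_head_arc := fun v h => by
        simp only [paddedDir, arcHead, arc, hlt v, if_true, headList, Set.mem_ofPred_eq,
          List.mem_cons] at h
        rcases h with h | h
        · omega
        · have := hf.lt _ _ h
          omega
      tail_last := by
        ext x
        simp only [paddedDir, arcTail, Fin.val_last, lt_irrefl, if_false, Set.mem_ofPred_eq,
          List.mem_range, Set.mem_range, node]
        exact ⟨fun h => ⟨ι.symm ⟨x, h⟩, by simp⟩, by rintro ⟨e, rfl⟩; exact (ι e).2⟩
      head_last := by
        ext x
        simp [paddedDir, arcHead, Fin.ext_iff]
      node_ne_source := fun e h => by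
        have := (ι e).2
        have := congrArg Fin.val h
        simp only [node] at this
        omega
      node_ne_target := fun e h => by
        have := (ι e).2
        have := congrArg Fin.val h
        simp only [node] at this
        omega
      source_ne_target := by simp }
  have himage : ∀ T ⊆ H.vertexSet,
      (fun a : Fin (n + 1) => (a : ℕ)) '' arcsOf arc (Fin.last n) T = insert n T := by
    intro T hT
    rw [arcsOf, Set.image_insert_eq, Set.image_image]
    refine congrArg (insert n) ?_
    ext x
    constructor
    · rintro ⟨v, hv, rfl⟩
      exact hv
    · exact fun hx => ⟨⟨x, hT hx⟩, hx, rfl⟩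
  change Set.image (fun a : Fin (n + 1) => (a : ℕ)) ''
    {P | (paddedDir n m f hf.lt).IsHyperpath ⟨m, by omega⟩ ⟨m + 1, by omega⟩ P} = _
  rw [← net.bijOn_arcsOf.image_eq, Set.image_image]
  exact Set.image_congr fun T hT => himage T hT.1.1

/-- Up to order, `l` is `n` followed by the filtered list, because `n` occurs once and all else is
below `n`. -/
theorem length_filter_lt {n : ℕ} {l : List ℕ} {T : Set ℕ} (hl : l.Nodup) (hT : T ⊆ Set.Iio n)
    (hlT : entries l = insert n T) :
    entries (l.filter (· < n)) = T ∧ (l.filter (· < n)).length = l.length - 1 ∧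
      l.length ≤ n + 1 := by
  have hmem : ∀ x, x ∈ l ↔ x = n ∨ x ∈ T := fun x => Set.ext_iff.1 hlT x
  have hlt : ∀ x ∈ T, x < n := fun x hx => hT hx
  refine ⟨?_, ?_, ?_⟩
  · ext x
    simp only [entries, Set.mem_ofPred_eq, List.mem_filter, decide_eq_true_eq, hmem]
    constructor
    · rintro ⟨rfl | h, h'⟩
      · exact (lt_irrefl _ h').elim
      · exact h
    · exact fun h => ⟨.inr h, hlt x h⟩
  · have : l.Perm (n :: l.filter (· < n)) := by
      refine (List.perm_ext_iff_of_nodup hl (by simp [hl.filter])).2 fun x => ?_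
      simp only [List.mem_cons, List.mem_filter, decide_eq_true_eq, hmem]
      constructor
      · rintro (h | h)
        · exact .inl h
        · exact .inr ⟨.inr h, hlt x h⟩
      · rintro (h | ⟨h, -⟩)
        · exact .inl h
        · exact h
    simp [this.length_eq]
  · have : l ⊆ List.range (n + 1) := fun x hx => by
      rcases (hmem x).1 hx with rfl | h
      · simp
      · have := hlt x h
        simp; omega
    simpa using (hl.subperm this).length_le

end Codes

/-! ### The linear-time bound and the reduction -/

section Reduction

local infixr:60 " ⨟ " => RAMProg.seq

open RAMProg

/-- The coefficients are natural numbers, so every monomial is monotone. -/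
theorem eval_mono (q : Polynomial ℕ) {a b : ℕ} (h : a ≤ b) : q.eval a ≤ q.eval b := by
  induction q using Polynomial.induction_on' with
  | add p q hp hq => simpa using add_le_add hp hq
  | monomial k c => simpa using Nat.mul_le_mul_left c (Nat.pow_le_pow_left h k)

theorem ListsFamily.length_le {n : ℕ} {H : Hypergraph ℕ} {L : List (List ℕ)}
    (hn : H.vertexSet = Set.Iio n) (hL : ListsFamily L H.edgeSet) :
    n + L.length ≤ hypergraphSize H + 1 := by
  have := length_le_sum_length_add_one hL.2.1.of_map
  rw [hypergraphSize_eq hn hL]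
  omega

theorem buildDir_runs_linear (b : Bool) {w : List ℕ} {n : ℕ} {H : Hypergraph ℕ}
    {L : List (List ℕ)} (hn : H.vertexSet = Set.Iio n) (hL : ListsFamily L H.edgeSet)
    (hw : w = n :: L.length :: (L.map block).flatten) :
    (buildDir b).Runs (RAMState.init w) (45 * (hypergraphSize H + 1)) fun τ =>
      BuildState w n L.length w.length (insertEdges 0 L fun _ => [])
        (dirCode b n L.length (insertEdges 0 L fun _ => [])) τ := by
  refine (buildDir_runs b hw rfl).mono ?_ fun _ h => h
  have h₁ := sum_length_insertEdges_le n (e := 0) hL.1 fun _ => []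
  have h₂ := hL.length_le hn
  rw [hypergraphSize_eq hn hL] at h₂ ⊢
  rw [← List.sum_toFinset _ List.nodup_range, List.toFinset_range]
  simp only [List.length_nil, Finset.sum_const_zero, zero_add] at h₁
  -- With `s` the sum of the hyperedge sizes, the incidence lists have total length at most `s` and
  -- there are at most `s + 1` hyperedges. The bound becomes `27 * s + 16 * n + 45`.
  omega

theorem exists_linear_time_construction :
    ∃ (p : RAMProg) (c : ℕ), ∀ (n : ℕ) (H : Hypergraph ℕ) (w : List ℕ),
      H.vertexSet = Set.Iio n → IsHypergraphCode n H w →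
      ∃ o, p.Computes w o (c * (hypergraphSize H + 1)) ∧
        ∃ (k : ℕ) (eV : Node H.edgeSet ≃ Fin k) (eA : Option H.vertexSet ≃ Fin (n + 1)),
          (∀ v : H.vertexSet, (eA (some v) : ℕ) = v) ∧
          (toDir H).IsCode eV eA Node.source Node.sink o := by
  refine ⟨buildDir false, 45, fun n H w hn ⟨L, hL, hw⟩ => ?_⟩
  obtain ⟨ι, hf⟩ := exists_incidenceLists hn hL
  obtain ⟨eV, eA, heA, hcode⟩ := hf.exists_isCode_toDir
  obtain ⟨τ, k, hk, he, hτ⟩ := buildDir_runs_linear false hn hL hw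
  exact ⟨_, ⟨τ, k, hk, he, RAMState.output_eq hτ.outLength hτ.out⟩, _, eV, eA, heA, hcode⟩

theorem writesBelow_buildDir (b : Bool) : (buildDir b).WritesBelow 20 10 := by
  cases b <;> simp [buildDir, readHypergraph, readEdge, insertEntry, emitHeader, emitArcs, emitArc,
    emitChain, emitCount, emitRange, emitSink, emit, onlyIf, WritesBelow]

/-- The register of the combined program that plays the role of the register `x`. -/
def subReg (x : ℕ) : ℕ := if x = 0 then 1 else x + 19

/-- The array of the combined program that plays the role of the array `a`. -/
def subArr (a : ℕ) : ℕ := if a = 0 then 1 else a + 9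

theorem subReg_injective : Function.Injective subReg := fun x y h => by
  unfold subReg at h
  split_ifs at h <;> omega

theorem subArr_injective : Function.Injective subArr := fun x y h => by
  unfold subArr at h
  split_ifs at h <;> omega

/-- Builds the padded directed hypergraph, runs `p` on it, and translates the output. -/
def viaHyperpaths (p : RAMProg) : RAMProg :=
  buildDir true ⨟ p.rename subReg subArr ⨟ translate

/-- No copying is needed: `subReg` and `subArr` send the input of `p` to register `1` and array `1`,
where `buildDir` leaves its output. The rest of the memory of `p` goes to registers from `20` and
arrays from `10` on, which `buildDir` never writes. -/
theorem viaHyperpaths_computes {p : RAMProg} {w : List ℕ} {n K : ℕ} {H : Hypergraph ℕ}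
    {L : List (List ℕ)} (hn : H.vertexSet = Set.Iio n) (hL : ListsFamily L H.edgeSet)
    (hw : w = n :: L.length :: (L.map block).flatten) {P : List (List ℕ)}
    (hp : p.Computes (dirCode true n L.length (insertEdges 0 L fun _ => []))
      (P.map block).flatten K)
    (hP : ∀ l ∈ P, (l.filter (· < n)).length = l.length - 1) :
    (viaHyperpaths p).Computes w ((P.map (List.filter (· < n))).map block).flatten
      (45 * (hypergraphSize H + 1) + (K + (9 * (P.map fun l => l.length + 1).sum + 7))) := by
  obtain ⟨τ, k, hk, he, hτ⟩ := buildDir_runs_linear true hn hL hw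
  obtain ⟨υ, k', hk', he', ho⟩ := hp
  obtain ⟨υ', he'', hreg, harr, hkeep⟩ := he'.rename subReg_injective subArr_injective (σ' := τ)
    (fun x => by
      by_cases hx : x = 0
      · subst hx
        simp [subReg, RAMState.init, hτ.outLength]
      · rw [subReg, if_neg hx, he.reg_eq (writesBelow_buildDir true) (by omega)]
        simp [RAMState.init, hx])
    (fun a => by
      by_cases ha : a = 0
      · subst ha
        simp only [subArr, if_true, hτ.out, RAMState.init, Function.update_self]
        rfl
      · rw [subArr, if_neg ha, he.arr_eq (writesBelow_buildDir true) (by omega)]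
        simp [RAMState.init, ha])
  -- Array `0` is not in the range of `subArr`, so the original input survives and `n` can be read
  -- again.
  have h0 : υ'.arr 0 0 = n := by
    rw [hkeep 0 (by rintro ⟨a, ha⟩; unfold subArr at ha; split_ifs at ha), hτ.input, hw]
    rfl
  have h10 : υ'.arr 10 = overlay (P.map block).flatten (υ.arr 1) := by
    rw [← ho, ← RAMState.arr_one_eq_overlay]
    exact harr 1
  have h20 : υ'.reg 20 = (P.map block).flatten.length := by
    rw [← ho, RAMState.output, List.length_map, List.length_range]
    exact hreg 1
  obtain ⟨φ, k'', hk'', hφ, hout⟩ := translate_runs h0 h10 h20 hP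
  exact ⟨φ, k + (k' + k''), by omega, he.seq (he''.seq hφ), hout⟩

theorem outputPolynomial_minTransversalEnum (h : hyperpathEnumBF.OutputPolynomial) :
    minTransversalEnum.OutputPolynomial := by
  obtain ⟨p, q, hpq⟩ := h
  -- At `X = S + N`, with `S` the size and `N` the number of solutions, `2 * (X + 3) ^ 2` bounds the
  -- padded size plus `N`. The term with `61 = 45 + 9 + 7` covers building and translating.
  refine ⟨viaHyperpaths p, q.comp (2 * (.X + 3) ^ 2) + 61 * (.X + 3) ^ 2, ?_⟩
  rintro ⟨n, H, hn⟩ w ⟨L, hL, hw⟩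
  obtain ⟨ι, hf⟩ := exists_incidenceLists hn hL
  obtain ⟨P, hP, hp⟩ := hpq _ _ hf.isCode_paddedInst
  rw [hf.solutions_paddedInst] at hP hp
  have hsub : ∀ T, IsMinimalTransversal H T → T ⊆ Set.Iio n := fun T hT => hn ▸ hT.1.1
  -- Minimal transversals avoid `n`, so both enumeration problems have the same number of solutions,
  -- and distinct hyperpaths stay distinct after deleting `n`.
  have hinj : Set.InjOn (insert n) {T | IsMinimalTransversal H T} := by
    intro T hT U hU hTU
    have hnT : n ∉ T := fun h => lt_irrefl n (hsub T hT h)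
    have hnU : n ∉ U := fun h => lt_irrefl n (hsub U hU h)
    rw [← Set.insert_sdiff_self_of_notMem hnT, hTU, Set.insert_sdiff_self_of_notMem hnU]
  have hmem : ∀ l ∈ P, ∃ T, IsMinimalTransversal H T ∧ entries l = insert n T := by
    intro l hl
    obtain ⟨T, hT, h⟩ := (hP.2.2 _).1 (List.mem_map_of_mem hl)
    exact ⟨T, hT, h.symm⟩
  have hfilter : ∀ l ∈ P, ∃ T, IsMinimalTransversal H T ∧ entries l = insert n T ∧
      entries (l.filter (· < n)) = T ∧ (l.filter (· < n)).length = l.length - 1 ∧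
      l.length ≤ n + 1 := by
    intro l hl
    obtain ⟨T, hT, h⟩ := hmem l hl
    exact ⟨T, hT, h, length_filter_lt (hP.1 l hl) (hsub T hT) h⟩
  refine ⟨P.map (List.filter (· < n)), ⟨?_, ?_, fun X => ⟨fun hX => ?_, fun hX => ?_⟩⟩, ?_⟩
  · intro l hl
    obtain ⟨l', hl', rfl⟩ := List.mem_map.1 hl
    exact (hP.1 l' hl').filter _
  · rw [List.map_map]
    refine hP.2.1.of_map.map_on fun l hl l' hl' hll' => ?_
    obtain ⟨T, -, h, h', -⟩ := hfilter l hl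
    obtain ⟨T', -, h₁, h₁', -⟩ := hfilter l' hl'
    refine List.inj_on_of_nodup_map hP.2.1 hl hl' ?_
    rw [h, h₁, ← h', ← h₁']
    exact congrArg (insert n) hll'
  · rw [List.map_map] at hX
    obtain ⟨l, hl, rfl⟩ := List.mem_map.1 hX
    obtain ⟨T, hT, -, h, -⟩ := hfilter l hl
    change IsMinimalTransversal H (entries (l.filter (· < n)))
    rwa [h]
  · obtain ⟨l, hl, hlX⟩ := List.mem_map.1 ((hP.2.2 _).2 ⟨X, hX, rfl⟩)
    obtain ⟨T, hT, h, h', -⟩ := hfilter l hl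
    have : T = X := hinj hT hX (h.symm.trans hlX)
    rw [List.map_map]
    exact List.mem_map.2 ⟨l, hl, h'.trans this⟩
  · obtain ⟨σ, k, hk, he, ho⟩ := viaHyperpaths_computes hn hL hw hp
      fun l hl => (hfilter l hl).choose_spec.2.2.2.1
    refine ⟨σ, k, hk.trans ?_, he, ho⟩
    have hN := hP.ncard_eq
    rw [hinj.ncard_image] at hN ⊢
    -- A hyperpath has at most `n + 1` hyperarcs, and its block has one further cell for the length.
    have hlen : (P.map fun l => l.length + 1).sum ≤ P.length * (n + 2) := by
      have := List.sum_le_card_nsmul (P.map fun l => l.length + 1) (n + 2) fun x hx => by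
        obtain ⟨l, hl, rfl⟩ := List.mem_map.1 hx
        obtain ⟨T, -, -, -, -, h⟩ := hfilter l hl
        omega
      simpa using this
    have hsize := size_paddedDir_le (n := n) hf.lt
    have hnm := hL.length_le hn
    change _ ≤ (q.comp (2 * (.X + 3) ^ 2) + 61 * (.X + 3) ^ 2 : Polynomial ℕ).eval
      (hypergraphSize H + Set.ncard {T | IsMinimalTransversal H T})
    change _ + (q.eval ((paddedDir n L.length _ hf.lt).size + _) + _) ≤ _
    rw [hN]
    set S := hypergraphSize H
    set N := P.length
    have hnS : n ≤ S := by
      have := hypergraphSize_eq hn hL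
      omega
    have h₁ : (paddedDir n L.length _ hf.lt).size + N ≤ 2 * (S + N + 3) ^ 2 := by
      have : (L.length + 2 + n) * (2 * n + 3) ≤ (S + 3) * (2 * S + 3) :=
        Nat.mul_le_mul (by omega) (by omega)
      nlinarith
    have h₂ := eval_mono q h₁
    have h₃ : P.length * (n + 2) ≤ (S + N + 3) * (S + N + 3) :=
      Nat.mul_le_mul (by omega) (by omega)
    simp only [Polynomial.eval_add, Polynomial.eval_comp, Polynomial.eval_mul,
      Polynomial.eval_pow, Polynomial.eval_X, Polynomial.eval_ofNat]
    nlinarith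

end Reduction

end HyperEnum

theorem mainTheorem3 :
    -- the directed hypergraph of `H` is a `BF`-hypergraph, it has no parallel hyperarcs
    -- if and only if distinct vertices of `H` lie in distinct sets of hyperedges, and
    -- `T ↦ pathOf H T` is a bijection from minimal transversals to `s`-`t` hyperpaths
    (∀ (α : Type*) (H : Hypergraph α),
      (toDir H).IsBF ∧
      ((toDir H).IsSimple ↔ ∀ u ∈ H.vertexSet, ∀ v ∈ H.vertexSet,
        (∀ e ∈ H.edgeSet, u ∈ e ↔ v ∈ e) → u = v) ∧
      Set.BijOn (pathOf H) {T | IsMinimalTransversal H T}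
        {P | (toDir H).IsHyperpath Node.source Node.sink P}) ∧
    -- it is built in linear time (the hyperarc of the vertex `v` gets the number `v`)
    (∃ (p : RAMProg) (c : ℕ), ∀ (n : ℕ) (H : Hypergraph ℕ) (w : List ℕ),
      H.vertexSet = Set.Iio n → IsHypergraphCode n H w →
      ∃ o, p.Computes w o (c * (hypergraphSize H + 1)) ∧
        ∃ (k : ℕ) (eV : Node H.edgeSet ≃ Fin k) (eA : Option H.vertexSet ≃ Fin (n + 1)),
          (∀ v : H.vertexSet, (eA (some v) : ℕ) = v) ∧
          (toDir H).IsCode eV eA Node.source Node.sink o) ∧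
    -- an output-polynomial algorithm for hyperpaths gives one for minimal transversals
    (hyperpathEnumBF.OutputPolynomial → minTransversalEnum.OutputPolynomial) :=
  -- `pathOf H` unfolds to `arcsOf some none`.
  ⟨fun _ H => ⟨toDir_isBF H, toDir_isSimple_iff H, (transversalNetwork_toDir H).bijOn_arcsOf⟩,
    exists_linear_time_construction, outputPolynomial_minTransversalEnum⟩
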